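/- For $m\ge 1$ put $\gamma^{[2m]}=\frac12+\frac i2\,\frac{\sin(\pi/(2m+1))}{1+\cos(\pi/(2m+1))}$, and fix $n\ge 1$. Write $\gamma'=\gamma^{[2n+2]}$, $\gamma=\gamma^{[2n]}$. Setting. Let $f$ be a holomorphic vector field on an open set $U\subseteq\mathbb C^d$ (for instance the holomorphic extension of a real analytic vector field), with exact flow $\varphi_h$, and let $\mathcal S_h$ be a one-step method, holomorphic in $(h,x)$ near $\{0\}\times U$. A method $M_h$ has order $r$ if $M_h(x)=\varphi_h(x)+\mathcal O(h^{r+1})$ as $h\to0$, is time-symmetric if $M_h\circ M_{-h}=\mathrm{id}$, and is pseudo-symmetric of order $q$ if $M_h(M_{-h}(x))=x+\mathcal O(h^{q+1})$, for every $x\in U$. Denote by $(\alpha_1,\dots,\alpha_s)$ the composition $\mathcal S_{\alpha_1h}\circ\cdots\circ\mathcal S_{\alpha_sh}$; it is symmetric-conjugate if $\bar\alpha_{s+1-j}=\alpha_j$ for all $j$, and consistent if $\sum_j\alpha_j=1$. Let $$\psi^{(1)}_h=(\gamma'\gamma,\ \gamma'\bar\gamma,\ \bar\gamma'\gamma,\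 \bar\gamma'\bar\gamma),\qquad \psi^{(2)}_h=(\gamma'\bar\gamma,\ \gamma'\gamma,\ \bar\gamma'\bar\gamma,\ \bar\gamma'\gamma),$$ let $\overline\psi{}^{(1)}_h,\overline\psi{}^{(2)}_h$ be the compositions with the complex conjugate coefficients, and $$T_h^{(2)}=\tfrac14\big(\psi_h^{(1)}+\psi_h^{(2)}+\overline\psi{}_h^{(1)}+\overline\psi{}_h^{(2)}\big).$$ Formal exponent. In formal power series in $h$ over the free associative algebra on letters $Y_1,Y_{2n+1},Y_{2n+3},\dots$, let $Y(h)=hY_1+\sum_{j\ge0}h^{2n+2j+1}Y_{2n+2j+1}$ and associate with $(\alpha_1,\dots,\alpha_s)$ the series $V(h)=\log\big(e^{Y(h\alpha_s)}\cdots e^{Y(h\alpha_1)}\big)$. For real numbers $\mu_{2n+1,1},\sigma_{2n+2,1},\mu_{2n+3,1},\mu_{2n+3,2}$ consider the expansion $$V(h)=hY_1+h^{2n+1}\mu_{2n+1,1}Y_{2n+1}+i\,h^{2n+2}\sigma_{2n+2,1}[Y_1,Y_{2n+1}]+h^{2n+3}\big(\mu_{2n+3,1}Y_{2n+3}+\mu_{2n+3,2}[Y_1,[Y_1,Y_{2n+1}]]\big)+\mathcal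 O(h^{2n+4}).\quad(*)$$ Statement. (1) All four compositions in $T^{(2)}_h$ are consistent and symmetric-conjugate. (2) $\psi^{(1)}$ and $\psi^{(2)}$ have expansions of the form $(*)$ with $\mu^{(j)}_{2n+1,1}=\mu^{(j)}_{2n+3,1}=0$ for $j=1,2$ and $\mu^{(2)}_{2n+3,2}=-\mu^{(1)}_{2n+3,2}\neq0$, so that the $\mu_{2n+3,2}$ terms of the two paired compositions cancel. (3) For every $d$, $U$, $f$ and $\mathcal S_h$ as above with $\mathcal S_h$ time-symmetric and of order $2n$, the method $T_h^{(2)}$ is of order $2n+4$ and pseudo-symmetric of order $4n+3$. (4) If moreover $\mathcal S_h$ is real, i.e. $\mathcal S_{\bar h}(\bar x)=\overline{\mathcal S_h(x)}$ near the points $(0,x)$ with $x\in U$ real, then for each real $x\in U$ and all sufficiently small real $h$, $\overline\psi{}^{(j)}_h(x)$ is the complex conjugate of $\psi^{(j)}_h(x)$ for $j=1,2$, and $T^{(2)}_h(x)=\frac12\,\Re\big(\psi_h^{(1)}(x)+\psi_h^{(2)}(x)\big)$. -/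

import Mathlib

open Filter Topology Asymptotics
open scoped ComplexConjugate

noncomputable section

namespace TMethod

/-! ### Numerical methods -/

/-- `φ` is the exact (complex-time, local) flow of `x' = f x` on `U`: for every initial value
`x ∈ U`, the curve `t ↦ φ t x` starts at `x` and solves the equation for all small times. -/
def IsExactFlow {d : ℕ} (f : (Fin d → ℂ) → (Fin d → ℂ)) (U : Set (Fin d → ℂ))
    (φ : ℂ → (Fin d → ℂ) → (Fin d → ℂ)) : Prop :=
  ∀ x ∈ U, φ 0 x = x ∧ ∀ᶠ h in 𝓝 (0 : ℂ), HasDerivAt (fun t => φ t x) (f (φ h x)) h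

/-- The one-step map `M` depends holomorphically on step size and point, near `{0} × U`. -/
def IsHolomorphicMethod {d : ℕ} (U : Set (Fin d → ℂ))
    (M : ℂ → (Fin d → ℂ) → (Fin d → ℂ)) : Prop :=
  ∀ x ∈ U, AnalyticAt ℂ (fun p : ℂ × (Fin d → ℂ) => M p.1 p.2) (0, x)

/-- The method `M` is of order `r`: `M_h(x) = φ_h(x) + O(h^(r+1))`, where `φ` is the exact flow. -/
def HasOrder {d : ℕ} (U : Set (Fin d → ℂ)) (φ M : ℂ → (Fin d → ℂ) → (Fin d → ℂ)) (r : ℕ) :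
    Prop :=
  ∀ x ∈ U, (fun h : ℂ => M h x - φ h x) =O[𝓝 0] (fun h : ℂ => h ^ (r + 1))

/-- The method `M` is time-symmetric: `M_h ∘ M_{-h} = id` (for small `h` at each point). -/
def IsTimeSymmetric {d : ℕ} (U : Set (Fin d → ℂ)) (M : ℂ → (Fin d → ℂ) → (Fin d → ℂ)) : Prop :=
  ∀ x ∈ U, ∀ᶠ h in 𝓝 (0 : ℂ), M h (M (-h) x) = x

/-- The method `M` is pseudo-symmetric of order `q`: `M_h ∘ M_{-h} = id + O(h^(q+1))`. -/
def IsPseudoSymmetric {d : ℕ} (U : Set (Fin d → ℂ)) (M : ℂ → (Fin d → ℂ) → (Fin d → ℂ))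
    (q : ℕ) : Prop :=
  ∀ x ∈ U, (fun h : ℂ => M h (M (-h) x) - x) =O[𝓝 0] (fun h : ℂ => h ^ (q + 1))

/-- The method `M` is real: near the real points of `U` (and step size `0`) it commutes with
complex conjugation; in particular `M_h(x)` is real for real `h` and `x`. -/
def IsRealMethod {d : ℕ} (U : Set (Fin d → ℂ)) (M : ℂ → (Fin d → ℂ) → (Fin d → ℂ)) : Prop :=
  ∀ x ∈ U, star x = x →
    ∀ᶠ p in 𝓝 ((0 : ℂ), x), M (conj p.1) (star p.2) = star (M p.1 p.2)

/-- The composition `(α₁, …, α_s)`, i.e. `S_{α₁ h} ∘ S_{α₂ h} ∘ ⋯ ∘ S_{α_s h}`. -/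
def composition {d : ℕ} (S : ℂ → (Fin d → ℂ) → (Fin d → ℂ)) (α : List ℂ) (h : ℂ) :
    (Fin d → ℂ) → (Fin d → ℂ) :=
  α.foldr (fun a g => S (a * h) ∘ g) id

/-- A symmetric-conjugate sequence of coefficients: `conj α_{s+1-j} = α_j` for all `j`. -/
def IsSymmetricConjugate (α : List ℂ) : Prop :=
  α.reverse.map (fun a => conj a) = α

/-! ### The method -/

/-- The coefficient `γ^[m] = 1/2 + (i/2) sin(π/(m+1)) / (1 + cos(π/(m+1)))`, used for `m` even. -/
def gam (m : ℕ) : ℂ :=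
  1 / 2 + Complex.I / 2 *
    ((Real.sin (Real.pi / (m + 1)) / (1 + Real.cos (Real.pi / (m + 1))) : ℝ) : ℂ)

/-- The coefficients of the first composition. -/
def coeffs₁ (n : ℕ) : List ℂ :=
  [gam (2 * n + 2) * gam (2 * n), gam (2 * n + 2) * conj (gam (2 * n)),
    conj (gam (2 * n + 2)) * gam (2 * n), conj (gam (2 * n + 2)) * conj (gam (2 * n))]

/-- The coefficients of the second composition. -/
def coeffs₂ (n : ℕ) : List ℂ :=
  [gam (2 * n + 2) * conj (gam (2 * n)), gam (2 * n + 2) * gam (2 * n),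
    conj (gam (2 * n + 2)) * conj (gam (2 * n)), conj (gam (2 * n + 2)) * gam (2 * n)]

/-- The coefficients of the third composition. -/
def coeffs₃ (n : ℕ) : List ℂ :=
  [conj (gam (2 * n + 2)) * conj (gam (2 * n)), conj (gam (2 * n + 2)) * gam (2 * n),
    gam (2 * n + 2) * conj (gam (2 * n)), gam (2 * n + 2) * gam (2 * n)]

/-- The coefficients of the fourth composition. -/
def coeffs₄ (n : ℕ) : List ℂ :=
  [conj (gam (2 * n + 2)) * gam (2 * n), conj (gam (2 * n + 2)) * conj (gam (2 * n)),
    gam (2 * n + 2) * gam (2 * n), gam (2 * n + 2) * conj (gam (2 * n))]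

/-- The method `T_h^(2)` built on the basic method `S` of order `2n`. -/
def T₂ {d : ℕ} (n : ℕ) (S : ℂ → (Fin d → ℂ) → (Fin d → ℂ)) (h : ℂ) (x : Fin d → ℂ) :
    Fin d → ℂ :=
  (1 / 4 : ℂ) • (composition S (coeffs₁ n) h x + composition S (coeffs₂ n) h x +
    composition S (coeffs₃ n) h x + composition S (coeffs₄ n) h x)

/-! ### The formal exponent of a composition

Formal power series in `h` whose coefficients are noncommutative polynomials in letters `Y k`. -/

/-- Formal power series in `h` over the free algebra on the letters `Y 0, Y 1, Y 2, …`. -/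
abbrev OpSeries : Type := PowerSeries (FreeAlgebra ℂ ℕ)

/-- The letter `Y k`. -/
def Y (k : ℕ) : FreeAlgebra ℂ ℕ := FreeAlgebra.ι ℂ k

/-- The series `Y(a h)`, where `Y(h) = h Y₁ + h^(2n+1) Y_{2n+1} + h^(2n+3) Y_{2n+3} + ⋯` is the
exponent of a time-symmetric basic method of order `2n`. -/
def basicExponent (n : ℕ) (a : ℂ) : OpSeries :=
  PowerSeries.mk fun k => if k = 1 ∨ (Odd k ∧ 2 * n + 1 ≤ k) then a ^ k • Y k else 0

/-- The formal exponential of a series `Z` without constant term. -/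
def formalExp (Z : OpSeries) : OpSeries :=
  PowerSeries.mk fun m =>
    ∑ k ∈ Finset.range (m + 1), ((k.factorial : ℂ)⁻¹) • PowerSeries.coeff m (Z ^ k)

/-- The formal logarithm `∑_{k ≥ 1} (-1)^(k+1) (P - 1)^k / k` of a series `P` with constant
term `1`. -/
def formalLog (P : OpSeries) : OpSeries :=
  PowerSeries.mk fun m =>
    ∑ k ∈ Finset.Icc 1 m, ((-1 : ℂ) ^ (k + 1) / (k : ℂ)) • PowerSeries.coeff m ((P - 1) ^ k)

/-- The series `V(h)` of the composition `(α₁, …, α_s)`: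
`exp(V(h)) = exp(Y(h α_s)) ⋯ exp(Y(h α₂)) exp(Y(h α₁))`. -/
def exponent (n : ℕ) (α : List ℂ) : OpSeries :=
  formalLog (α.map fun a => formalExp (basicExponent n a)).reverse.prod

/-- The exponent of the composition with coefficients `α` has the expansion
`V(h) = h Y₁ + h^(2n+1) μ_{2n+1,1} Y_{2n+1} + i h^(2n+2) σ_{2n+2,1} [Y₁, Y_{2n+1}]
  + h^(2n+3) (μ_{2n+3,1} Y_{2n+3} + μ_{2n+3,2} [Y₁, [Y₁, Y_{2n+1}]]) + O(h^(2n+4))`. -/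
structure HasExpansion (n : ℕ) (α : List ℂ) (μ11 σ21 μ31 μ32 : ℝ) : Prop where
  coeff_zero : PowerSeries.coeff 0 (exponent n α) = 0
  coeff_one : PowerSeries.coeff 1 (exponent n α) = Y 1
  coeff_mid : ∀ k, 2 ≤ k → k ≤ 2 * n → PowerSeries.coeff k (exponent n α) = 0
  coeff_first : PowerSeries.coeff (2 * n + 1) (exponent n α) = (μ11 : ℂ) • Y (2 * n + 1)
  coeff_second : PowerSeries.coeff (2 * n + 2) (exponent n α) =
    (Complex.I * (σ21 : ℂ)) • ⁅Y 1, Y (2 * n + 1)⁆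
  coeff_third : PowerSeries.coeff (2 * n + 3) (exponent n α) =
    (μ31 : ℂ) • Y (2 * n + 3) + (μ32 : ℂ) • ⁅Y 1, ⁅Y 1, Y (2 * n + 1)⁆⁆

end TMethod

end

/-!
A one-step method `M` acts on holomorphic functions by `g ↦ g ∘ M h`, and the Taylor coefficients
in `h` make this action a power series with operator coefficients; composing methods multiplies
these series in reverse order, and the exact flow becomes `exp(h x)` with `x` the Lie derivative
along the vector field. The formal exponents are governed by the same algebra, with `x` the
letter `Y₁`.

Let `N = 2n + 1`. Time symmetry and order `2n` give the basic method the series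
`exp(½ h x) (1 + h ^ N (g₀ + g₂ h² + ⋯)) exp(½ h x)`, without a term of degree `N + 1` in the
middle factor. In a composition with coefficients `αⱼ`, the error of each step is conjugated by
`exp(τⱼ h x)`, with `τⱼ` the position of the step relative to the center of the composition. Hence
`g₀` and `g₂` are multiplied by `∑ αⱼ ^ N` and `∑ αⱼ ^ (N + 2)`, and the remaining terms are
multiples of `[x, g₀]` and `[x, [x, g₀]]`, given by the first and second moments of the `τⱼ` with
weights `αⱼ ^ N`. Both power sums vanish, because `γ ^ (2n+1)` and `γ' ^ (2n+3)` are purely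
imaginary. The first moments cancel between complex conjugate compositions and the second moments
between `ψ⁽¹⁾` and `ψ⁽²⁾`, so the average has order at least `2n + 3`.

Reversing a symmetric-conjugate sequence conjugates it, and composing with the reversed sequence
at `-h` gives the identity. So the set of the four compositions is closed under adjoints, and the
failure of their average to be symmetric is quadratic in their differences, which are
`O(h ^ (2n+2))`. This gives pseudo-symmetry of order `4n + 3`; and as the error of a
symmetric scheme starts at an odd power of `h`, the order is in fact `2n + 4`.
-/

noncomputable section

namespace TMethod

/-! ### Power series over a noncommutative algebra -/

open PowerSeries (X C coeff constantCoeff)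
open scoped PowerSeries

section AgreeBelow

variable {A : Type*} [Ring A] {K : ℕ} {P Q R S : A⟦X⟧}

/-- Congruence of power series modulo `X ^ K`, phrased through coefficients because `A` need not be
commutative. -/
def AgreeBelow (K : ℕ) (P Q : A⟦X⟧) : Prop :=
  ∀ k < K, coeff k P = coeff k Q

namespace AgreeBelow

lemma symm (h : AgreeBelow K P Q) : AgreeBelow K Q P := fun k hk => (h k hk).symm

lemma trans (h : AgreeBelow K P Q) (h' : AgreeBelow K Q R) : AgreeBelow K P R :=
  fun k hk => (h k hk).trans (h' k hk)

lemma mono {L : ℕ} (h : AgreeBelow K P Q) (hL : L ≤ K) : AgreeBelow L P Q :=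
  fun k hk => h k (hk.trans_le hL)

lemma sub_right (h : AgreeBelow K P Q) (R : A⟦X⟧) : AgreeBelow K (P - R) (Q - R) :=
  fun k hk => by rw [map_sub, map_sub, h k hk]

lemma mul (h : AgreeBelow K P Q) (h' : AgreeBelow K R S) : AgreeBelow K (P * R) (Q * S) := by
  intro k hk
  simp only [PowerSeries.coeff_mul]
  refine Finset.sum_congr rfl fun p hp => ?_
  have := Finset.HasAntidiagonal.mem_antidiagonal.mp hp
  rw [h p.1 (by omega), h' p.2 (by omega)]

lemma pow (h : AgreeBelow K P Q) (k : ℕ) : AgreeBelow K (P ^ k) (Q ^ k) := by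
  induction k with
  | zero => exact fun _ _ => by rw [pow_zero, pow_zero]
  | succ k ih => rw [pow_succ, pow_succ]; exact ih.mul h

lemma add (h : AgreeBelow K P Q) (h' : AgreeBelow K R S) : AgreeBelow K (P + R) (Q + S) :=
  fun k hk => by rw [map_add, map_add, h k hk, h' k hk]

end AgreeBelow

lemma agreeBelow_sub_zero_iff : AgreeBelow K (P - Q) 0 ↔ AgreeBelow K P Q := by
  simp only [AgreeBelow, map_sub, map_zero, sub_eq_zero]

lemma agreeBelow_add_X_pow_mul (P G : A⟦X⟧) (K : ℕ) : AgreeBelow K (P + X ^ K * G) P := by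
  intro k hk
  rw [map_add, PowerSeries.coeff_X_pow_mul', if_neg hk.not_ge, add_zero]

lemma AgreeBelow.X_pow_mul (h : AgreeBelow K P Q) (N : ℕ) :
    AgreeBelow (N + K) (X ^ N * P) (X ^ N * Q) := by
  intro k hk
  rw [PowerSeries.coeff_X_pow_mul', PowerSeries.coeff_X_pow_mul']
  split_ifs
  exacts [h (k - N) (by omega), rfl]

lemma agreeBelow_zero_iff : AgreeBelow K P 0 ↔ ∃ G, P = X ^ K * G := by
  simpa only [AgreeBelow, map_zero, Dvd.dvd] using (PowerSeries.X_pow_dvd_iff (φ := P)).symm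

lemma AgreeBelow.exists_eq_add (h : AgreeBelow K P Q) : ∃ G, P = Q + X ^ K * G := by
  obtain ⟨G, hG⟩ := agreeBelow_zero_iff.mp (agreeBelow_sub_zero_iff.mpr h)
  exact ⟨G, eq_add_of_sub_eq' hG⟩

lemma X_pow_mul_mul_X_pow_mul (m n : ℕ) (P Q : A⟦X⟧) :
    X ^ m * P * (X ^ n * Q) = X ^ (m + n) * (P * Q) := by
  rw [mul_assoc, ← mul_assoc P, ← PowerSeries.X_pow_mul, pow_add]
  simp only [mul_assoc]

lemma mul_X_pow_mul (P : A⟦X⟧) (n : ℕ) (Q : A⟦X⟧) : P * (X ^ n * Q) = X ^ n * (P * Q) := by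
  simpa only [pow_zero, one_mul, zero_add] using X_pow_mul_mul_X_pow_mul 0 n P Q

lemma AgreeBelow.mul_zero_zero {L : ℕ} (h : AgreeBelow K P 0) (h' : AgreeBelow L Q 0) :
    AgreeBelow (K + L) (P * Q) 0 := by
  obtain ⟨G, rfl⟩ := agreeBelow_zero_iff.mp h
  obtain ⟨H, rfl⟩ := agreeBelow_zero_iff.mp h'
  exact agreeBelow_zero_iff.mpr ⟨G * H, X_pow_mul_mul_X_pow_mul ..⟩

lemma agreeBelow_one_zero (hP : constantCoeff P = 0) : AgreeBelow 1 P 0 := by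
  intro k hk
  rw [Nat.lt_one_iff.mp hk, PowerSeries.coeff_zero_eq_constantCoeff_apply, hP, map_zero]

lemma agreeBelow_pow_zero (hP : constantCoeff P = 0) (k : ℕ) : AgreeBelow k (P ^ k) 0 := by
  induction k with
  | zero => exact fun _ hk => absurd hk (Nat.not_lt_zero _)
  | succ k ih => rw [pow_succ]; exact ih.mul_zero_zero (agreeBelow_one_zero hP)

lemma AgreeBelow.pow_succ (h : AgreeBelow K P Q) (hP : constantCoeff P = 0)
    (hQ : constantCoeff Q = 0) (k : ℕ) : AgreeBelow (K + k) (P ^ (k + 1)) (Q ^ (k + 1)) := by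
  induction k with
  | zero => simpa only [zero_add, add_zero, pow_one] using h
  | succ k ih =>
    have hsplit : P ^ (k + 1 + 1) - Q ^ (k + 1 + 1) =
        (P ^ (k + 1) - Q ^ (k + 1)) * P + Q ^ (k + 1) * (P - Q) := by
      rw [_root_.pow_succ P (k + 1), _root_.pow_succ Q (k + 1)]
      noncomm_ring
    rw [← agreeBelow_sub_zero_iff, hsplit, ← add_zero (0 : A⟦X⟧)]
    refine .add ?_ ?_
    · exact (agreeBelow_sub_zero_iff.mpr ih).mul_zero_zero (agreeBelow_one_zero hP)
    · rw [add_comm K]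
      exact (agreeBelow_pow_zero hQ (k + 1)).mul_zero_zero (agreeBelow_sub_zero_iff.mpr h)

end AgreeBelow

section Substitution

variable {𝕜 A : Type*} [Field 𝕜] [Ring A] [Algebra 𝕜 A] {Z : A⟦X⟧}

/-- The series `f(Z)`, for a scalar series `f` and a series `Z` without constant term over a
noncommutative algebra, where `PowerSeries.subst` is not available. -/
def ncSubst (Z : A⟦X⟧) (f : 𝕜⟦X⟧) : A⟦X⟧ :=
  PowerSeries.mk fun m => ∑ k ∈ Finset.range (m + 1), coeff k f • coeff m (Z ^ k)

lemma coeff_ncSubst (hZ : constantCoeff Z = 0) (f : 𝕜⟦X⟧) {m K : ℕ} (hm : m < K) :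
    coeff m (ncSubst Z f) = ∑ k ∈ Finset.range K, coeff k f • coeff m (Z ^ k) := by
  rw [ncSubst, PowerSeries.coeff_mk]
  refine Finset.sum_subset (Finset.range_mono hm) fun k _ hk => ?_
  rw [agreeBelow_pow_zero hZ k m (by simpa using hk), map_zero, smul_zero]

lemma AgreeBelow.ncSubst {P Q : A⟦X⟧} {K : ℕ} (h : AgreeBelow K P Q) (f : 𝕜⟦X⟧) :
    AgreeBelow K (ncSubst P f) (ncSubst Q f) := fun m hm => by
  simp only [TMethod.ncSubst, PowerSeries.coeff_mk, h.pow _ m hm]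

lemma agreeBelow_ncSubst_add {K : ℕ} (hK : 2 ≤ K) (hZ : constantCoeff Z = 0) (G : A⟦X⟧)
    (f : 𝕜⟦X⟧) :
    AgreeBelow (K + 2) (ncSubst (Z + X ^ K * G) f)
      (ncSubst Z f + X ^ K * (coeff 1 f • G + coeff 2 f • (Z * G + G * Z))) := by
  intro m hm
  have hZ' : constantCoeff (Z + X ^ K * G) = 0 := by
    rw [map_add, hZ, zero_add, map_mul, map_pow, PowerSeries.constantCoeff_X,
      zero_pow (by omega), zero_mul]
  have hsq : (Z + X ^ K * G) ^ 2 = Z ^ 2 + X ^ K * (Z * G + G * Z) + X ^ (K + K) * (G * G) := by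
    rw [← X_pow_mul_mul_X_pow_mul, mul_add (X ^ K), ← mul_X_pow_mul, ← mul_assoc (X ^ K)]
    noncomm_ring
  have hhigh (k : ℕ) : coeff m ((Z + X ^ K * G) ^ (k + 3)) = coeff m (Z ^ (k + 3)) :=
    (agreeBelow_add_X_pow_mul Z G K).pow_succ hZ' hZ (k + 2) m (by omega)
  obtain ⟨K, rfl⟩ := Nat.exists_eq_add_of_le' hK
  rw [map_add, coeff_ncSubst hZ' f (show m < K + 1 + 3 by omega),
    coeff_ncSubst hZ f (show m < K + 1 + 3 by omega)]
  simp only [Finset.sum_range_succ' _ (_ + 2), Finset.sum_range_succ' _ (_ + 1),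
    hhigh, hsq, zero_add, pow_zero, pow_one, map_add, mul_add, mul_smul_comm,
    PowerSeries.coeff_smul]
  rw [PowerSeries.coeff_X_pow_mul' (G * G), if_neg (by omega)]
  module

lemma coeff_ncSubst_eq_coeff_aeval (hZ : constantCoeff Z = 0) {f : 𝕜⟦X⟧} {p : Polynomial 𝕜} {m : ℕ}
    (hp : ∀ k ≤ m, p.coeff k = coeff k f) :
    coeff m (ncSubst Z f) = coeff m (Polynomial.aeval Z p) := by
  rw [Polynomial.aeval_eq_sum_range' (Nat.lt_succ_of_le (le_max_left p.natDegree m)), map_sum,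
    coeff_ncSubst hZ f (Nat.lt_succ_of_le (le_max_right p.natDegree m))]
  refine Finset.sum_congr rfl fun k _ => ?_
  rw [PowerSeries.coeff_smul]
  rcases le_or_gt k m with hk | hk
  · rw [hp k hk]
  · rw [agreeBelow_pow_zero hZ k m hk, map_zero, smul_zero, smul_zero]

lemma ncSubst_mul (hZ : constantCoeff Z = 0) (f g : 𝕜⟦X⟧) :
    ncSubst Z (f * g) = ncSubst Z f * ncSubst Z g := by
  ext m
  have htrunc (f : 𝕜⟦X⟧) {j k : ℕ} (hk : k < j) : (f.trunc j).coeff k = coeff k f := by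
    rw [PowerSeries.coeff_trunc, if_pos hk]
  rw [coeff_ncSubst_eq_coeff_aeval hZ (p := f.trunc (m + 1) * g.trunc (m + 1)), map_mul,
    PowerSeries.coeff_mul, PowerSeries.coeff_mul]
  · refine Finset.sum_congr rfl fun p hp => ?_
    have := Finset.HasAntidiagonal.mem_antidiagonal.mp hp
    rw [coeff_ncSubst_eq_coeff_aeval hZ fun k hk => htrunc f (by omega : k < m + 1),
      coeff_ncSubst_eq_coeff_aeval hZ fun k hk => htrunc g (by omega : k < m + 1)]
  · intro k hk
    rw [PowerSeries.coeff_mul_eq_coeff_trunc_mul_trunc f g (Nat.lt_succ_of_le hk),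
      ← Polynomial.coe_mul, Polynomial.coeff_coe]

lemma ncSubst_one (Z : A⟦X⟧) : ncSubst Z (1 : 𝕜⟦X⟧) = 1 := by
  ext m
  simp [ncSubst, PowerSeries.coeff_one, ite_smul]

lemma ncSubst_pow (hZ : constantCoeff Z = 0) (f : 𝕜⟦X⟧) (k : ℕ) :
    ncSubst Z (f ^ k) = ncSubst Z f ^ k := by
  induction k with
  | zero => rw [pow_zero, pow_zero, ncSubst_one]
  | succ k ih => rw [pow_succ, pow_succ, ncSubst_mul hZ, ih]

lemma ncSubst_X (hZ : constantCoeff Z = 0) : ncSubst Z (X : 𝕜⟦X⟧) = Z := by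
  ext m
  simp [coeff_ncSubst hZ _ (show m < m + 2 by omega), PowerSeries.coeff_X, ite_smul]

lemma coeff_subst_eq_sum_range {g : 𝕜⟦X⟧} (hg : constantCoeff g = 0) (f : 𝕜⟦X⟧) {j K : ℕ}
    (hj : j < K) :
    coeff j (f.subst g) = ∑ k ∈ Finset.range K, coeff k f * coeff j (g ^ k) := by
  rw [PowerSeries.coeff_subst' (.of_constantCoeff_zero' hg)]
  refine finsum_eq_sum_of_support_subset _ fun k hk => ?_
  rw [Finset.coe_range, Set.mem_Iio]
  by_contra hKk
  exact hk (by simp only [agreeBelow_pow_zero hg k j (by omega), map_zero, smul_zero])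

lemma ncSubst_subst (hZ : constantCoeff Z = 0) {g : 𝕜⟦X⟧} (hg : constantCoeff g = 0) (f : 𝕜⟦X⟧) :
    ncSubst Z (f.subst g) = ncSubst (ncSubst Z g) f := by
  ext m
  have hterm (k : ℕ) : coeff k f • coeff m (ncSubst Z g ^ k) =
      ∑ j ∈ Finset.range (m + 1), (coeff k f * coeff j (g ^ k)) • coeff m (Z ^ j) := by
    rw [← ncSubst_pow hZ, ncSubst, PowerSeries.coeff_mk, Finset.smul_sum]
    exact Finset.sum_congr rfl fun j _ => smul_smul ..
  rw [ncSubst, ncSubst, PowerSeries.coeff_mk, PowerSeries.coeff_mk,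
    Finset.sum_congr rfl fun k _ => hterm k, Finset.sum_comm]
  refine Finset.sum_congr rfl fun j hj => ?_
  rw [coeff_subst_eq_sum_range hg f (Finset.mem_range.mp hj), Finset.sum_smul]

lemma logOf_exp [CharZero 𝕜] : PowerSeries.logOf (PowerSeries.exp 𝕜) = X := by
  let φ := PowerSeries.substAlgHom (R := 𝕜) (PowerSeries.HasSubst.exp_sub_one (A := 𝕜))
  have hφ (f : 𝕜⟦X⟧) : f.subst (PowerSeries.exp 𝕜 - 1) = φ f := by
    rw [PowerSeries.coe_substAlgHom]
  have hgeom : (PowerSeries.mk fun n => algebraMap ℚ 𝕜 ((-1) ^ n)) * (1 + X) = 1 := by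
    ext (_ | n) <;> simp [mul_add, pow_succ]
  have hexp : φ (1 + X) = PowerSeries.exp 𝕜 := by
    rw [map_add, map_one, ← hφ, PowerSeries.subst_X .exp_sub_one, add_sub_cancel]
  refine PowerSeries.derivative.ext ?_ (by simp [PowerSeries.constantCoeff_logOf])
  calc PowerSeries.derivative 𝕜 (PowerSeries.logOf (PowerSeries.exp 𝕜))
      = φ (PowerSeries.mk fun n => algebraMap ℚ 𝕜 ((-1) ^ n)) * PowerSeries.exp 𝕜 := by
        rw [PowerSeries.logOf_eq, PowerSeries.derivative_subst .exp_sub_one, PowerSeries.deriv_log,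
          map_sub, Derivation.map_one_eq_zero, sub_zero, PowerSeries.derivative_exp, hφ]
    _ = 1 := by rw [← hexp, ← map_mul, hgeom, map_one]
    _ = PowerSeries.derivative 𝕜 X := PowerSeries.derivative_X.symm

end Substitution

section Scaling

variable {𝕜 A : Type*} [Field 𝕜] [Ring A] [Algebra 𝕜 A]

/-- The rescaling `h ↦ a h` of the variable; `PowerSeries.rescale` needs commutative
coefficients. -/
def scaleHom (a : 𝕜) : A⟦X⟧ →ₐ[𝕜] A⟦X⟧ where
  toFun P := PowerSeries.mk fun m => a ^ m • coeff m P
  map_zero' := by ext; simp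
  map_one' := by ext m; by_cases h : m = 0 <;> simp [PowerSeries.coeff_one, h]
  map_add' P Q := by ext; simp
  map_mul' P Q := by
    ext m
    simp only [PowerSeries.coeff_mk, PowerSeries.coeff_mul, Finset.smul_sum]
    refine Finset.sum_congr rfl fun p hp => ?_
    rw [smul_mul_smul_comm, ← pow_add, Finset.HasAntidiagonal.mem_antidiagonal.mp hp]
  commutes' c := by
    ext m; by_cases h : m = 0 <;> simp [PowerSeries.algebraMap_apply, PowerSeries.coeff_C, h]

@[simp] lemma coeff_scaleHom (a : 𝕜) (P : A⟦X⟧) (m : ℕ) :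
    coeff m (scaleHom a P) = a ^ m • coeff m P :=
  PowerSeries.coeff_mk m fun m => a ^ m • coeff m P

lemma scaleHom_scaleHom (a b : 𝕜) (P : A⟦X⟧) :
    scaleHom a (scaleHom b P) = scaleHom (a * b) P := by
  ext m; simp [smul_smul, mul_pow]

lemma scaleHom_X_pow_mul (a : 𝕜) (N : ℕ) (P : A⟦X⟧) :
    scaleHom a (X ^ N * P) = X ^ N * (a ^ N • scaleHom a P) := by
  ext m
  by_cases h : N ≤ m
  · obtain ⟨d, rfl⟩ := Nat.exists_eq_add_of_le' h
    simp [-map_mul, PowerSeries.coeff_X_pow_mul, smul_smul, pow_add, mul_comm]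
  · simp [-map_mul, PowerSeries.coeff_X_pow_mul', h]

lemma scaleHom_ncSubst (a : 𝕜) (Z : A⟦X⟧) (f : 𝕜⟦X⟧) :
    scaleHom a (ncSubst Z f) = ncSubst (scaleHom a Z) f := by
  ext m
  simp [ncSubst, Finset.smul_sum, ← map_pow, smul_comm (a ^ m)]

/-- The series of the composition of a scheme with series `P` along the coefficients `α`. The
factors appear in reverse order: this is the convention for the exponentials in `exponent`, and also
for the operators `g ↦ g ∘ M`. -/
def compositionSeries (P : A⟦X⟧) (α : List 𝕜) : A⟦X⟧ :=
  (α.map fun a => scaleHom a P).reverse.prod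

lemma compositionSeries_nil (P : A⟦X⟧) : compositionSeries P ([] : List 𝕜) = 1 := rfl

lemma compositionSeries_append (P : A⟦X⟧) (α β : List 𝕜) :
    compositionSeries P (α ++ β) = compositionSeries P β * compositionSeries P α := by
  simp only [compositionSeries, List.map_append, List.reverse_append, List.prod_append]

lemma compositionSeries_singleton (P : A⟦X⟧) (a : 𝕜) :
    compositionSeries P [a] = scaleHom a P := by
  simp only [compositionSeries, List.map_singleton, List.reverse_singleton, List.prod_singleton]

lemma compositionSeries_cons (P : A⟦X⟧) (a : 𝕜) (α : List 𝕜) :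
    compositionSeries P (a :: α) = compositionSeries P α * scaleHom a P := by
  rw [← List.singleton_append, compositionSeries_append, compositionSeries_singleton]

variable [CharZero 𝕜]

/-- The series `exp(a h x)` in `h`, which stands for the exact flow over a step of length `a h`. -/
def expSeries (x : A) (a : 𝕜) : A⟦X⟧ :=
  ncSubst (C x * X) (PowerSeries.rescale a (PowerSeries.exp 𝕜))

lemma coeff_C_mul_X_pow (x : A) (k m : ℕ) :
    coeff m ((C x * X) ^ k) = if m = k then x ^ k else 0 := by
  rw [(PowerSeries.commute_X (C x)).mul_pow, ← map_pow, PowerSeries.coeff_C_mul,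
    PowerSeries.coeff_X_pow, mul_ite, mul_one, mul_zero]

@[simp] lemma coeff_expSeries (x : A) (a : 𝕜) (m : ℕ) :
    coeff m (expSeries x a) = (a ^ m * (m.factorial : 𝕜)⁻¹) • x ^ m := by
  simp [expSeries, ncSubst, coeff_C_mul_X_pow, PowerSeries.coeff_exp]

lemma expSeries_mul (x : A) (a b : 𝕜) :
    expSeries x a * expSeries x b = expSeries x (a + b) := by
  rw [expSeries, expSeries, expSeries, ← ncSubst_mul (by simp),
    PowerSeries.exp_mul_exp_eq_exp_add]

lemma expSeries_zero (x : A) : expSeries x (0 : 𝕜) = 1 := by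
  ext m
  by_cases h : m = 0 <;> simp [PowerSeries.coeff_one, h]

lemma scaleHom_expSeries (x : A) (a b : 𝕜) :
    scaleHom a (expSeries x b) = expSeries x (a * b) := by
  ext m; simp [smul_smul, mul_pow, mul_assoc]

end Scaling

/-! ### Centered expansions -/

section CenteredExpansion

section LowCoefficients

variable {R : Type*} [Semiring R] (P Q : R⟦X⟧)

lemma coeff_zero_mul_eq : coeff 0 (P * Q) = coeff 0 P * coeff 0 Q := by
  simp [PowerSeries.coeff_mul]

lemma coeff_one_mul_eq : coeff 1 (P * Q) = coeff 0 P * coeff 1 Q + coeff 1 P * coeff 0 Q := by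
  simp [PowerSeries.coeff_mul, Finset.Nat.antidiagonal_succ]

lemma coeff_two_mul_eq :
    coeff 2 (P * Q) = coeff 0 P * coeff 2 Q + coeff 1 P * coeff 1 Q + coeff 2 P * coeff 0 Q := by
  simp [PowerSeries.coeff_mul, Finset.Nat.antidiagonal_succ, add_assoc]

end LowCoefficients

section Commutator

variable {𝕜 A : Type*} [CommSemiring 𝕜] [Ring A] [Algebra 𝕜 A]

lemma lie_smul_right (t : 𝕜) (x y : A) : ⁅x, t • y⁆ = t • ⁅x, y⁆ := by
  rw [Ring.lie_def, Ring.lie_def, mul_smul_comm, smul_mul_assoc, smul_sub]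

lemma lie_zero_right (x : A) : ⁅x, (0 : A)⁆ = 0 := by
  rw [Ring.lie_def, mul_zero, zero_mul, sub_zero]

end Commutator

variable {𝕜 A : Type*} [Field 𝕜] [CharZero 𝕜] [Ring A] [Algebra 𝕜 A] {N : ℕ} {x : A}

/-- `R = exp(½ a h x) (1 + h ^ N (g₀ + g₁ h + g₂ h² + ⋯)) exp(½ a h x)`. Putting the error terms
between two half steps makes them behave like the exponent of a symmetric scheme: time symmetry
removes `g₁`, and composition conjugates by exponentials of `h x`, which only produces commutators
with `x`. -/
def HasCenteredExpansion (N : ℕ) (x : A) (a : 𝕜) (R : A⟦X⟧) (g₀ g₁ g₂ : A) : Prop :=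
  ∃ G : A⟦X⟧, R = expSeries x (a / 2) * (1 + X ^ N * G) * expSeries x (a / 2) ∧
    coeff 0 G = g₀ ∧ coeff 1 G = g₁ ∧ coeff 2 G = g₂

lemma expSeries_mul_expSeries_neg (x : A) (a : 𝕜) : expSeries x a * expSeries x (-a) = 1 := by
  rw [expSeries_mul, add_neg_cancel, expSeries_zero]

lemma expSeries_neg_mul_expSeries (x : A) (a : 𝕜) : expSeries x (-a) * expSeries x a = 1 := by
  rw [expSeries_mul, neg_add_cancel, expSeries_zero]

lemma coeff_zero_conj (x : A) (τ : 𝕜) (G : A⟦X⟧) :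
    coeff 0 (expSeries x τ * G * expSeries x (-τ)) = coeff 0 G := by
  simp [coeff_zero_mul_eq, -PowerSeries.coeff_zero_eq_constantCoeff]

lemma coeff_one_conj (x : A) (τ : 𝕜) (G : A⟦X⟧) :
    coeff 1 (expSeries x τ * G * expSeries x (-τ)) = coeff 1 G + τ • ⁅x, coeff 0 G⁆ := by
  simp only [coeff_zero_mul_eq, coeff_one_mul_eq, coeff_expSeries, Ring.lie_def, smul_mul_assoc,
    mul_smul_comm, pow_zero, pow_one, one_mul, mul_one]
  norm_num
  module

lemma coeff_two_conj (x : A) (τ : 𝕜) (G : A⟦X⟧) :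
    coeff 2 (expSeries x τ * G * expSeries x (-τ)) =
      coeff 2 G + τ • ⁅x, coeff 1 G⁆ + (τ ^ 2 / 2) • ⁅x, ⁅x, coeff 0 G⁆⁆ := by
  simp only [coeff_zero_mul_eq, coeff_one_mul_eq, coeff_two_mul_eq, coeff_expSeries, Ring.lie_def,
    smul_mul_assoc, mul_smul_comm, mul_add, mul_sub, sub_mul, pow_zero, pow_one, one_mul,
    mul_one, pow_two, mul_assoc]
  norm_num
  module

lemma conj_one_add_X_pow_mul (x : A) (τ : 𝕜) (G : A⟦X⟧) :
    expSeries x τ * (1 + X ^ N * G) * expSeries x (-τ) =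
      1 + X ^ N * (expSeries x τ * G * expSeries x (-τ)) := by
  rw [mul_add, add_mul, mul_one, expSeries_mul_expSeries_neg, mul_X_pow_mul, mul_assoc (X ^ N)]

/-- Moving both inner exponentials outwards conjugates the first error factor by `exp(-½ b h x)` and
the second one by `exp(½ a h x)`. -/
lemma centered_mul_centered (x : A) (a b : 𝕜) (P Q : A⟦X⟧) :
    expSeries x (a / 2) * P * expSeries x (a / 2) *
        (expSeries x (b / 2) * Q * expSeries x (b / 2)) =
      expSeries x ((a + b) / 2) *
        ((expSeries x (-(b / 2)) * P * expSeries x (- -(b / 2))) *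
          (expSeries x (a / 2) * Q * expSeries x (-(a / 2)))) * expSeries x ((a + b) / 2) := by
  have hleft : expSeries x (a / 2) = expSeries x ((a + b) / 2) * expSeries x (-(b / 2)) := by
    rw [expSeries_mul]; congr 1; ring
  have hmid : expSeries x (a / 2) * expSeries x (b / 2) =
      expSeries x (- -(b / 2)) * expSeries x (a / 2) := by
    rw [expSeries_mul, expSeries_mul]; congr 1; ring
  have hright : expSeries x (b / 2) = expSeries x (-(a / 2)) * expSeries x ((a + b) / 2) := by
    rw [expSeries_mul]; congr 1; ring
  calc _ = expSeries x (a / 2) * P * (expSeries x (a / 2) * expSeries x (b / 2)) * Q *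
        expSeries x (b / 2) := by simp only [mul_assoc]
    _ = expSeries x ((a + b) / 2) * expSeries x (-(b / 2)) * P *
        (expSeries x (- -(b / 2)) * expSeries x (a / 2)) * Q *
        (expSeries x (-(a / 2)) * expSeries x ((a + b) / 2)) := by
      rw [hmid, ← hleft, ← hright]
    _ = _ := by simp only [mul_assoc]

namespace HasCenteredExpansion

variable {a b : 𝕜} {P R S : A⟦X⟧} {g₀ g₁ g₂ k₀ k₁ k₂ : A}

lemma mul (hN : 3 ≤ N) (hR : HasCenteredExpansion N x a R g₀ g₁ g₂)
    (hS : HasCenteredExpansion N x b S k₀ k₁ k₂) :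
    HasCenteredExpansion N x (a + b) (R * S) (g₀ + k₀)
      (g₁ + (-(b / 2)) • ⁅x, g₀⁆ + (k₁ + (a / 2) • ⁅x, k₀⁆))
      (g₂ + (-(b / 2)) • ⁅x, g₁⁆ + ((-(b / 2)) ^ 2 / 2) • ⁅x, ⁅x, g₀⁆⁆ +
        (k₂ + (a / 2) • ⁅x, k₁⁆ + ((a / 2) ^ 2 / 2) • ⁅x, ⁅x, k₀⁆⁆)) := by
  obtain ⟨G, rfl, rfl, rfl, rfl⟩ := hR
  obtain ⟨K, rfl, rfl, rfl, rfl⟩ := hS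
  set G' := expSeries x (-(b / 2)) * G * expSeries x (- -(b / 2)) with hG'
  set K' := expSeries x (a / 2) * K * expSeries x (-(a / 2)) with hK'
  have hprod : (1 + X ^ N * G') * (1 + X ^ N * K') =
      1 + X ^ N * (G' + K' + X ^ N * (G' * K')) := by
    rw [mul_add, mul_one, add_mul, one_mul, X_pow_mul_mul_X_pow_mul, pow_add, mul_assoc (X ^ N),
      mul_add, mul_add]
    abel
  refine ⟨G' + K' + X ^ N * (G' * K'), ?_, ?_, ?_, ?_⟩
  · rw [centered_mul_centered, conj_one_add_X_pow_mul, conj_one_add_X_pow_mul, ← hprod]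
  all_goals
    rw [map_add, map_add, PowerSeries.coeff_X_pow_mul', if_neg (by omega), add_zero, hG', hK']
  · rw [coeff_zero_conj, coeff_zero_conj]
  · rw [coeff_one_conj, coeff_one_conj]
  · rw [coeff_two_conj, coeff_two_conj]

lemma scale (h : HasCenteredExpansion N x b R g₀ g₁ g₂) (a : 𝕜) :
    HasCenteredExpansion N x (a * b) (scaleHom a R) (a ^ N • g₀) (a ^ (N + 1) • g₁)
      (a ^ (N + 2) • g₂) := by
  obtain ⟨G, rfl, rfl, rfl, rfl⟩ := h
  refine ⟨a ^ N • scaleHom a G, ?_, ?_, ?_, ?_⟩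
  · rw [map_mul, map_mul, map_add, map_one, scaleHom_X_pow_mul, scaleHom_expSeries, mul_div_assoc]
  all_goals simp [smul_smul, pow_add, -PowerSeries.coeff_zero_eq_constantCoeff]

lemma one (N : ℕ) (x : A) : HasCenteredExpansion N x (0 : 𝕜) 1 0 0 0 :=
  ⟨0, by simp [expSeries_zero], map_zero _, map_zero _, map_zero _⟩

lemma sum {ι : Type*} [Fintype ι] {w : ι → 𝕜} (hw : ∑ i, w i = 1) {R : ι → A⟦X⟧}
    {g₀ g₁ g₂ : ι → A} (h : ∀ i, HasCenteredExpansion N x a (R i) (g₀ i) (g₁ i) (g₂ i)) :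
    HasCenteredExpansion N x a (∑ i, w i • R i) (∑ i, w i • g₀ i) (∑ i, w i • g₁ i)
      (∑ i, w i • g₂ i) := by
  choose G hR h₀ h₁ h₂ using h
  refine ⟨∑ i, w i • G i, ?_, by simp only [map_sum, PowerSeries.coeff_smul, h₀],
    by simp only [map_sum, PowerSeries.coeff_smul, h₁],
    by simp only [map_sum, PowerSeries.coeff_smul, h₂]⟩
  have hone : 1 + X ^ N * ∑ i, w i • G i = ∑ i, w i • (1 + X ^ N * G i) := by
    simp only [smul_add, Finset.sum_add_distrib, ← Finset.sum_smul, hw, one_smul, Finset.mul_sum,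
      mul_smul_comm]
  rw [hone]
  simp only [hR, Finset.mul_sum, Finset.sum_mul, mul_smul_comm, smul_mul_assoc]

lemma exists_eq_expSeries_add (h : HasCenteredExpansion N x a R g₀ g₁ g₂) :
    ∃ G : A⟦X⟧, R = expSeries x a + X ^ N * (expSeries x (a / 2) * G * expSeries x (a / 2)) ∧
      coeff 0 G = g₀ ∧ coeff 1 G = g₁ ∧ coeff 2 G = g₂ := by
  obtain ⟨G, rfl, hG⟩ := h
  refine ⟨G, ?_, hG⟩
  rw [mul_add, add_mul, mul_one, expSeries_mul, add_halves, mul_X_pow_mul, mul_assoc (X ^ N)]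

lemma agreeBelow_succ (h : HasCenteredExpansion N x a R 0 g₁ g₂) :
    AgreeBelow (N + 1) R (expSeries x a) := by
  obtain ⟨G, rfl, hG, -⟩ := h.exists_eq_expSeries_add
  have hzero : AgreeBelow 1 G 0 := fun k hk => by rw [Nat.lt_one_iff.mp hk, hG, map_zero]
  obtain ⟨H, rfl⟩ := agreeBelow_zero_iff.mp hzero
  rw [mul_X_pow_mul, mul_assoc (X ^ 1), ← mul_assoc, ← pow_add]
  exact agreeBelow_add_X_pow_mul _ _ _

lemma agreeBelow_add_three (h : HasCenteredExpansion N x a R 0 0 0) :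
    AgreeBelow (N + 3) R (expSeries x a) := by
  obtain ⟨G, rfl, hG₀, hG₁, hG₂⟩ := h.exists_eq_expSeries_add
  have hzero : AgreeBelow 3 G 0 := fun k hk => by interval_cases k <;> simpa only [map_zero]
  obtain ⟨H, rfl⟩ := agreeBelow_zero_iff.mp hzero
  rw [mul_X_pow_mul, mul_assoc (X ^ 3), ← mul_assoc, ← pow_add]
  exact agreeBelow_add_X_pow_mul _ _ _

end HasCenteredExpansion

lemma AgreeBelow.exists_hasCenteredExpansion {a : 𝕜} {R : A⟦X⟧}
    (h : AgreeBelow N R (expSeries x a)) :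
    ∃ g₁ g₂, HasCenteredExpansion N x a R (coeff N R - coeff N (expSeries x a)) g₁ g₂ := by
  obtain ⟨D, rfl⟩ := h.exists_eq_add
  set G := expSeries x (-(a / 2)) * D * expSeries x (-(a / 2)) with hG
  have hD : expSeries x (a / 2) * G * expSeries x (a / 2) = D := by
    rw [hG, mul_assoc, mul_assoc, mul_assoc, expSeries_neg_mul_expSeries, mul_one, ← mul_assoc,
      expSeries_mul_expSeries_neg, one_mul]
  have hG₀ : coeff 0 G = coeff N (expSeries x a + X ^ N * D) - coeff N (expSeries x a) := by
    rw [map_add, add_sub_cancel_left, PowerSeries.coeff_X_pow_mul', if_pos le_rfl, Nat.sub_self,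
      hG, coeff_zero_mul_eq, coeff_zero_mul_eq]
    simp only [coeff_expSeries, pow_zero, Nat.factorial_zero, Nat.cast_one, inv_one, mul_one,
      one_smul, one_mul]
  refine ⟨coeff 1 G, coeff 2 G, G, ?_, hG₀, rfl, rfl⟩
  rw [mul_add, add_mul, mul_one, expSeries_mul, add_halves, mul_X_pow_mul, mul_assoc (X ^ N), hD]

/-- Symmetry forces `g₁ = -g₁`, as rescaling by `-1` multiplies `g₁` by `(-1) ^ (N + 1) = 1`. -/
lemma HasCenteredExpansion.eq_zero_of_symmetric {P : A⟦X⟧} {g₀ g₁ g₂ : A} (hN : 3 ≤ N)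
    (hodd : Odd N) (h : HasCenteredExpansion N x (1 : 𝕜) P g₀ g₁ g₂)
    (hsym : scaleHom (-1 : 𝕜) P * P = 1) : g₁ = 0 := by
  obtain ⟨G, hG, -, hG₁, -⟩ := (h.scale (-1)).mul hN h
  have hprod : (1 : A⟦X⟧) = 1 + X ^ N * G := by
    simpa only [hsym, mul_one, neg_add_cancel, zero_div, expSeries_zero, one_mul] using hG
  have hzero : coeff 1 G = 0 := by
    rw [← PowerSeries.coeff_X_pow_mul G N 1, left_eq_add.mp hprod, map_zero]
  have htwo : (2 : 𝕜) • g₁ = 0 := by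
    rw [← hzero, hG₁, hodd.neg_one_pow, hodd.add_one.neg_one_pow, lie_smul_right]
    module
  exact (smul_eq_zero_iff_right two_ne_zero).mp htwo

lemma AgreeBelow.exists_hasCenteredExpansion_of_symmetric {P : A⟦X⟧} (hN : 3 ≤ N) (hodd : Odd N)
    (hP : AgreeBelow N P (expSeries x (1 : 𝕜))) (hsym : scaleHom (-1 : 𝕜) P * P = 1) :
    ∃ W, HasCenteredExpansion N x (1 : 𝕜) P (coeff N P - coeff N (expSeries x (1 : 𝕜))) 0 W := by
  obtain ⟨g₁, W, h⟩ := hP.exists_hasCenteredExpansion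
  exact ⟨W, h.eq_zero_of_symmetric hN hodd hsym ▸ h⟩

end CenteredExpansion

section QuadSums

variable {R : Type*} [CommSemiring R] {p q g k : R}

lemma sum_quad : [p * g, p * k, q * g, q * k].sum = (p + q) * (g + k) := by
  simp only [List.sum_cons, List.sum_nil]
  ring

lemma sum_pow_quad (m : ℕ) :
    ([p * g, p * k, q * g, q * k].map (· ^ m)).sum = (p ^ m + q ^ m) * (g ^ m + k ^ m) := by
  simp only [List.map_cons, List.map_nil, List.sum_cons, List.sum_nil, mul_pow]
  ring

end QuadSums

section Composition

variable {𝕜 A : Type*} [Field 𝕜] [CharZero 𝕜] [Ring A] [Algebra 𝕜 A] {N : ℕ} {x : A}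

/-- The sum `∑ⱼ αⱼ ^ N τⱼ`, where `τⱼ = ½ (∑ᵢ αᵢ over i > j) - ½ (∑ᵢ αᵢ over i < j)` is the position
of the `j`-th step relative to the center of the composition; prepending a step of length `a` shifts
the others by `-½ a`. -/
def firstMoment (N : ℕ) : List 𝕜 → 𝕜
  | [] => 0
  | a :: α => firstMoment N α - a / 2 * (α.map (· ^ N)).sum + α.sum / 2 * a ^ N

/-- The sum `∑ⱼ αⱼ ^ N τⱼ ^ 2`, with `τⱼ` as in `firstMoment`. -/
def secondMoment (N : ℕ) : List 𝕜 → 𝕜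
  | [] => 0
  | a :: α => secondMoment N α - a * firstMoment N α + a ^ 2 / 4 * (α.map (· ^ N)).sum +
      α.sum ^ 2 / 4 * a ^ N

lemma HasCenteredExpansion.compositionSeries {P : A⟦X⟧} {Z W : A} (hN : 3 ≤ N)
    (hP : HasCenteredExpansion N x (1 : 𝕜) P Z 0 W) (α : List 𝕜) :
    HasCenteredExpansion N x α.sum (compositionSeries P α) ((α.map (· ^ N)).sum • Z)
      (firstMoment N α • ⁅x, Z⁆)
      ((secondMoment N α / 2) • ⁅x, ⁅x, Z⁆⁆ + (α.map (· ^ (N + 2))).sum • W) := by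
  induction α with
  | nil => simpa [firstMoment, secondMoment, compositionSeries_nil] using one N x
  | cons a α ih =>
    have h := ih.mul hN (hP.scale a)
    simp only [compositionSeries_cons, List.map_cons, List.sum_cons, firstMoment, secondMoment]
    convert h using 1
    · rw [mul_one, add_comm]
    · rw [add_smul, add_comm]
    · simp only [lie_smul_right]
      module
    · simp only [lie_smul_right, lie_zero_right, smul_zero]
      module

variable {p q g k : 𝕜}

lemma firstMoment_quad (hpq : p + q = 1) (hgk : g + k = 1) (hN : g ^ N + k ^ N = 0) :
    firstMoment N [p * g, p * k, q * g, q * k] = g ^ N / 2 * (p ^ (N + 1) + q ^ (N + 1)) := by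
  obtain rfl := eq_sub_of_add_eq' hgk
  obtain rfl := eq_sub_of_add_eq' hpq
  simp only [firstMoment, List.map_cons, List.map_nil, List.sum_cons, List.sum_nil, mul_pow,
    eq_neg_of_add_eq_zero_right hN]
  ring

lemma secondMoment_quad (hpq : p + q = 1) (hgk : g + k = 1) (hN : g ^ N + k ^ N = 0)
    (hN₂ : p ^ (N + 2) + q ^ (N + 2) = 0) :
    secondMoment N [p * g, p * k, q * g, q * k] = g ^ N / 2 * (p * q * (p ^ N - q ^ N)) := by
  obtain rfl := eq_sub_of_add_eq' hgk
  obtain rfl := eq_sub_of_add_eq' hpq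
  simp only [secondMoment, firstMoment, List.map_cons, List.map_nil, List.sum_cons, List.sum_nil,
    mul_pow, eq_neg_of_add_eq_zero_right hN]
  linear_combination g ^ N * (1 - 2 * g) / 4 * hN₂

end Composition

section Symmetric

variable {𝕜 A : Type*} [Field 𝕜] [Ring A] [Algebra 𝕜 A]

lemma AgreeBelow.scaleHom {K : ℕ} {P Q : A⟦X⟧} (h : AgreeBelow K P Q) (a : 𝕜) :
    AgreeBelow K (scaleHom a P) (scaleHom a Q) := fun k hk => by
  rw [coeff_scaleHom, coeff_scaleHom, h k hk]

lemma scaleHom_neg_one_compositionSeries_mul {P : A⟦X⟧} (hsym : scaleHom (-1 : 𝕜) P * P = 1)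
    (α : List 𝕜) :
    scaleHom (-1 : 𝕜) (compositionSeries P α) * compositionSeries P α.reverse = 1 := by
  have hstep (a : 𝕜) : scaleHom (-1 : 𝕜) (scaleHom a P) * scaleHom a P = 1 := by
    rw [scaleHom_scaleHom, mul_comm, ← scaleHom_scaleHom, ← map_mul, hsym, map_one]
  induction α with
  | nil => rw [List.reverse_nil, compositionSeries_nil, map_one, one_mul]
  | cons a α ih =>
    rw [List.reverse_cons, compositionSeries_append, compositionSeries_singleton,
      compositionSeries_cons, map_mul, mul_assoc, ← mul_assoc (scaleHom (-1 : 𝕜) (scaleHom a P)),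
      hstep, one_mul, ih]

/-- Written through differences only, so that the right-hand side is quadratically small where the
`R i` agree with each other and so do the `S i`. -/
lemma two_smul_sum_mul_sum_sub_one {ι B : Type*} [Fintype ι] [Ring B] [Algebra 𝕜 B] {w : ι → 𝕜}
    (hw : ∑ i, w i = 1) {σ : Equiv.Perm ι} (hσ : ∀ i, w (σ i) = w i) {S R : ι → B}
    (hSR : ∀ i, S i * R (σ i) = 1) :
    (2 : 𝕜) • ((∑ i, w i • S i) * ∑ i, w i • R i - 1) =
      ∑ i, ∑ j, (w i * w j) • ((S i - S (σ.symm j)) * (R j - R (σ i))) := by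
  have hSR' (j : ι) : S (σ.symm j) * R j = 1 := by
    simpa only [σ.apply_symm_apply] using hSR (σ.symm j)
  have hprod : (∑ i, w i • S i) * ∑ i, w i • R i = ∑ i, ∑ j, (w i * w j) • (S i * R j) := by
    simp only [Finset.sum_mul_sum, smul_mul_smul_comm]
  have hreindex : ∑ i, ∑ j, (w i * w j) • (S (σ.symm j) * R (σ i)) =
      ∑ i, ∑ j, (w i * w j) • (S i * R j) := by
    rw [Finset.sum_comm, ← Equiv.sum_comp σ]
    refine Finset.sum_congr rfl fun j _ => ?_
    rw [← Equiv.sum_comp σ.symm]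
    refine Finset.sum_congr rfl fun i _ => ?_
    rw [σ.symm_apply_apply, σ.apply_symm_apply, hσ, ← hσ (σ.symm i), σ.apply_symm_apply, mul_comm]
  have hone : ∑ i, ∑ j, (w i * w j) • (1 : B) = 1 := by
    simp only [← Finset.sum_smul, ← Finset.mul_sum, hw, mul_one, one_smul]
  have hterm (i j : ι) : (w i * w j) • ((S i - S (σ.symm j)) * (R j - R (σ i))) =
      (w i * w j) • (S i * R j) - (w i * w j) • (1 : B) - (w i * w j) • (1 : B) +
        (w i * w j) • (S (σ.symm j) * R (σ i)) := by
    rw [sub_mul, mul_sub, mul_sub, hSR, hSR']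
    module
  simp only [hterm, Finset.sum_add_distrib, Finset.sum_sub_distrib, hreindex, hone, ← hprod]
  module

lemma AgreeBelow.symmetric_sum [CharZero 𝕜] {ι : Type*} [Fintype ι] {w : ι → 𝕜}
    (hw : ∑ i, w i = 1) {σ : Equiv.Perm ι} (hσ : ∀ i, w (σ i) = w i) {m : ℕ} {R : ι → A⟦X⟧}
    (hR : ∀ i j, AgreeBelow m (R i) (R j))
    (hsym : ∀ i, TMethod.scaleHom (-1 : 𝕜) (R i) * R (σ i) = 1) :
    AgreeBelow (m + m) (TMethod.scaleHom (-1 : 𝕜) (∑ i, w i • R i) * ∑ i, w i • R i) 1 := by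
  rw [← agreeBelow_sub_zero_iff]
  intro k hk
  have hsmall (i j : ι) : coeff k ((TMethod.scaleHom (-1 : 𝕜) (R i) -
      TMethod.scaleHom (-1 : 𝕜) (R (σ.symm j))) * (R j - R (σ i))) = 0 :=
    (agreeBelow_sub_zero_iff.mpr ((hR _ _).scaleHom _)).mul_zero_zero
      (agreeBelow_sub_zero_iff.mpr (hR _ _)) k hk
  have htwo := congrArg (coeff k) (two_smul_sum_mul_sum_sub_one hw hσ hsym)
  simp only [map_sum, PowerSeries.coeff_smul, hsmall, smul_zero, Finset.sum_const_zero] at htwo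
  simpa only [map_sum, map_smul, map_zero] using (smul_eq_zero_iff_right two_ne_zero).mp htwo

/-- The classical fact that a symmetric scheme has even order. -/
lemma AgreeBelow.succ_of_symmetric [CharZero 𝕜] {r m : ℕ} (hr : Even r) (hr₀ : r ≠ 0) (hrm : r < m)
    {x : A} {Q : A⟦X⟧} (hQ : AgreeBelow r Q (expSeries x (1 : 𝕜)))
    (hsym : AgreeBelow m (TMethod.scaleHom (-1 : 𝕜) Q * Q) 1) :
    AgreeBelow (r + 1) Q (expSeries x (1 : 𝕜)) := by
  obtain ⟨G, rfl⟩ := hQ.exists_eq_add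
  have hprod : TMethod.scaleHom (-1 : 𝕜) (expSeries x (1 : 𝕜) + X ^ r * G) *
      (expSeries x (1 : 𝕜) + X ^ r * G) = 1 + X ^ r * (expSeries x (-1 : 𝕜) * G +
        TMethod.scaleHom (-1 : 𝕜) G * expSeries x (1 : 𝕜) +
        X ^ r * (TMethod.scaleHom (-1 : 𝕜) G * G)) := by
    rw [map_add, scaleHom_expSeries, scaleHom_X_pow_mul, hr.neg_one_pow, one_smul, mul_one, mul_add,
      add_mul, add_mul, expSeries_neg_mul_expSeries, X_pow_mul_mul_X_pow_mul, mul_X_pow_mul,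
      pow_add,
      mul_add, mul_add]
    simp only [mul_assoc]
    abel
  have hG : (2 : 𝕜) • coeff 0 G = 0 := by
    have h := hsym r hrm
    rw [hprod, map_add, add_eq_left, PowerSeries.coeff_X_pow_mul', if_pos le_rfl, Nat.sub_self,
      map_add, map_add, PowerSeries.coeff_X_pow_mul', if_neg (by omega), coeff_zero_mul_eq,
      coeff_zero_mul_eq, coeff_scaleHom] at h
    simpa [two_smul, -PowerSeries.coeff_zero_eq_constantCoeff] using h
  have hzero : AgreeBelow 1 G 0 := fun k hk => by
    rw [Nat.lt_one_iff.mp hk, (smul_eq_zero_iff_right two_ne_zero).mp hG, map_zero]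
  obtain ⟨H, rfl⟩ := agreeBelow_zero_iff.mp hzero
  rw [← mul_assoc, ← pow_add]
  exact agreeBelow_add_X_pow_mul _ _ _

end Symmetric

section Logarithm

variable {𝕜 A : Type*} [Field 𝕜] [CharZero 𝕜] [Ring A] [Algebra 𝕜 A] {N : ℕ} {x : A}

lemma ncSubst_exp_sub_one_log {Z : A⟦X⟧} (hZ : constantCoeff Z = 0) :
    ncSubst (ncSubst Z (PowerSeries.exp 𝕜) - 1) (PowerSeries.log 𝕜) = Z := by
  have hsub : ncSubst Z (PowerSeries.exp 𝕜 - 1) = ncSubst Z (PowerSeries.exp 𝕜) - 1 := by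
    ext m
    rw [map_sub, ← ncSubst_one (𝕜 := 𝕜) Z]
    simp only [ncSubst, PowerSeries.coeff_mk, map_sub, sub_smul, Finset.sum_sub_distrib]
  have hexp : constantCoeff (PowerSeries.exp 𝕜 - 1) = 0 := by simp
  rw [← hsub, ← ncSubst_subst hZ hexp, ← PowerSeries.logOf_eq, logOf_exp, ncSubst_X hZ]

lemma constantCoeff_C_mul_X (x : A) : constantCoeff (C x * X) = 0 := by simp

lemma expSeries_one (x : A) : expSeries x (1 : 𝕜) = ncSubst (C x * X) (PowerSeries.exp 𝕜) := by
  rw [expSeries, PowerSeries.rescale_one, RingHom.id_apply]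

lemma agreeBelow_ncSubst_exp (hN : 2 ≤ N) (x : A) (G : A⟦X⟧) :
    AgreeBelow (N + 2) (ncSubst (C x * X + X ^ N * G) (PowerSeries.exp 𝕜))
      (expSeries x (1 : 𝕜) + X ^ N * (G + (2⁻¹ : 𝕜) • (C x * X * G + G * (C x * X)))) := by
  have h := agreeBelow_ncSubst_add hN (constantCoeff_C_mul_X x) G (PowerSeries.exp 𝕜)
  rw [← expSeries_one] at h
  simpa [PowerSeries.coeff_exp] using h

lemma HasCenteredExpansion.agreeBelow_log {R : A⟦X⟧} {g₁ g₂ : A} (hN : 1 ≤ N)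
    (h : HasCenteredExpansion N x (1 : 𝕜) R 0 g₁ g₂) :
    AgreeBelow (N + 3) (ncSubst (R - 1) (PowerSeries.log 𝕜))
      (C x * X + X ^ (N + 1) * (C g₁ + C g₂ * X)) := by
  set D : A⟦X⟧ := C g₁ + C g₂ * X with hD
  have hU : constantCoeff (C x * X + X ^ (N + 1) * D) = 0 := by simp
  have hexp := agreeBelow_ncSubst_exp (𝕜 := 𝕜) (show 2 ≤ N + 1 by omega) x D
  have hR : AgreeBelow (N + 3) R
      (expSeries x (1 : 𝕜) + X ^ (N + 1) * (D + (2⁻¹ : 𝕜) • (C x * X * D + D * (C x * X)))) := by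
    obtain ⟨G, rfl, hG₀, hG₁, hG₂⟩ := h.exists_eq_expSeries_add
    have hzero : AgreeBelow 1 G 0 := fun k hk => by rw [Nat.lt_one_iff.mp hk, hG₀, map_zero]
    obtain ⟨H, rfl⟩ := agreeBelow_zero_iff.mp hzero
    rw [PowerSeries.coeff_X_pow_mul' H, if_pos (by omega)] at hG₁ hG₂
    rw [mul_X_pow_mul, mul_assoc (X ^ 1), ← mul_assoc (X ^ N), ← pow_add]
    refine .add (fun _ _ => rfl) (AgreeBelow.X_pow_mul (K := 2) (fun k hk => ?_) (N + 1))
    interval_cases k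
    · simp [coeff_zero_mul_eq, hD, ← hG₁, -PowerSeries.coeff_zero_eq_constantCoeff]
    · simp only [coeff_one_mul_eq, coeff_zero_mul_eq, coeff_expSeries, pow_zero, pow_one,
        Nat.factorial_zero, Nat.factorial_one, Nat.cast_one, inv_one, mul_one, one_mul, one_smul,
        Algebra.mul_smul_comm, Algebra.smul_mul_assoc, hD, ← hG₁, ← hG₂, tsub_self,
        Nat.add_one_sub_one, smul_add, map_add, PowerSeries.coeff_succ_C,
        PowerSeries.coeff_succ_mul_X, PowerSeries.coeff_zero_C, zero_add,
        LinearMap.map_smul_of_tower, PowerSeries.coeff_C_mul, PowerSeries.coeff_zero_X, mul_zero,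
        zero_mul, add_zero]
      module
  have hRU : AgreeBelow (N + 3) R (ncSubst (C x * X + X ^ (N + 1) * D) (PowerSeries.exp 𝕜)) :=
    hR.trans hexp.symm
  simpa only [ncSubst_exp_sub_one_log hU] using (hRU.sub_right 1).ncSubst (PowerSeries.log 𝕜)

end Logarithm

/-! ### The coefficients of the compositions -/

section Coefficients

lemma exists_gam_eq {m : ℕ} (hm : 1 ≤ m) : ∃ r : ℝ, 0 < r ∧
    gam m = (r : ℂ) * Complex.exp ((Real.pi / (2 * (m + 1)) : ℝ) * Complex.I) := by
  set t : ℝ := Real.pi / (2 * (m + 1)) with ht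
  have hm₀ : (0 : ℝ) < m := by exact_mod_cast hm
  have ht₀ : 0 < t := by positivity
  have ht_lt : t < Real.pi / 2 := by
    rw [ht, div_lt_div_iff₀ (by positivity) two_pos]
    nlinarith [Real.pi_pos]
  have hcos : 0 < Real.cos t := Real.cos_pos_of_mem_Ioo ⟨by linarith, ht_lt⟩
  have hcos' : (Real.cos t : ℂ) ≠ 0 := by exact_mod_cast hcos.ne'
  have hdouble : Real.pi / (m + 1) = 2 * t := by rw [ht]; field_simp
  have htan : Real.sin (2 * t) / (1 + Real.cos (2 * t)) = Real.sin t / Real.cos t := by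
    rw [Real.sin_two_mul, Real.cos_two_mul]
    field_simp
    ring
  refine ⟨(2 * Real.cos t)⁻¹, by positivity, ?_⟩
  rw [gam, hdouble, htan, Complex.exp_mul_I, ← Complex.ofReal_cos, ← Complex.ofReal_sin]
  push_cast [-Complex.ofReal_cos, -Complex.ofReal_sin]
  field_simp

lemma gam_add_conj (m : ℕ) : gam m + conj (gam m) = 1 := by
  have hre : (gam m).re = 1 / 2 := by
    rw [gam, Complex.add_re, Complex.re_mul_ofReal]
    norm_num
  rw [Complex.add_conj, hre]
  norm_num

lemma exists_gam_pow_succ_eq {m : ℕ} (hm : 1 ≤ m) :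
    ∃ r : ℝ, 0 < r ∧ gam m ^ (m + 1) = r * Complex.I := by
  obtain ⟨r, hr, h⟩ := exists_gam_eq hm
  refine ⟨r ^ (m + 1), by positivity, ?_⟩
  have hangle : ((m + 1 : ℕ) : ℂ) * (((Real.pi / (2 * (m + 1)) : ℝ) : ℂ) * Complex.I) =
      Real.pi / 2 * Complex.I := by
    have : (m : ℂ) + 1 ≠ 0 := by exact_mod_cast m.succ_ne_zero
    push_cast
    field_simp
  rw [h, mul_pow, ← Complex.exp_nat_mul, hangle, Complex.exp_pi_div_two_mul_I, Complex.ofReal_pow]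

lemma gam_pow_succ_add_conj {m : ℕ} (hm : 1 ≤ m) :
    gam m ^ (m + 1) + conj (gam m) ^ (m + 1) = 0 := by
  obtain ⟨r, -, h⟩ := exists_gam_pow_succ_eq hm
  rw [← map_pow, h, map_mul, Complex.conj_ofReal, Complex.conj_I, mul_neg, add_neg_cancel]

lemma gam_pow_im_pos {m k : ℕ} (hk : 1 ≤ k) (hkm : k ≤ m) : 0 < (gam m ^ k).im := by
  obtain ⟨r, hr, h⟩ := exists_gam_eq (hk.trans hkm)
  rw [h, mul_pow, ← Complex.exp_nat_mul, ← Complex.ofReal_pow,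
    Complex.im_ofReal_mul, ← mul_assoc, ← Complex.ofReal_natCast, ← Complex.ofReal_mul,
    Complex.exp_ofReal_mul_I_im]
  have : (0 : ℝ) < k := by exact_mod_cast hk
  have hkm' : (k : ℝ) ≤ m := by exact_mod_cast hkm
  refine mul_pos (by positivity) (Real.sin_pos_of_pos_of_lt_pi (by positivity) ?_)
  rw [mul_div_assoc', div_lt_iff₀ (by positivity)]
  nlinarith [Real.pi_pos]

/-- The four coefficient sequences of `T₂`, indexed so that reversal is addition of `2`. -/
def coeffs (n : ℕ) : Fin 4 → List ℂ := ![coeffs₁ n, coeffs₂ n, coeffs₃ n, coeffs₄ n]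

lemma coeffs_reverse (n : ℕ) (i : Fin 4) : (coeffs n i).reverse = coeffs n (i + 2) := by
  fin_cases i <;> rfl

lemma coeffs_map_conj (n : ℕ) (i : Fin 4) :
    (coeffs n i).map (fun a => conj a) = coeffs n (i + 2) := by
  fin_cases i <;> simp [coeffs, coeffs₁, coeffs₂, coeffs₃, coeffs₄]

lemma isSymmetricConjugate_coeffs (n : ℕ) (i : Fin 4) : IsSymmetricConjugate (coeffs n i) := by
  rw [IsSymmetricConjugate, coeffs_reverse, coeffs_map_conj, add_assoc]
  exact congrArg (coeffs n) (add_zero i)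

lemma coeffs_sum (n : ℕ) (i : Fin 4) : (coeffs n i).sum = 1 := by
  have hp := gam_add_conj (2 * n + 2)
  have hg := gam_add_conj (2 * n)
  have hp' := (add_comm _ _).trans hp
  have hg' := (add_comm _ _).trans hg
  fin_cases i <;> refine sum_quad.trans ?_ <;> simp only [hp, hp', hg, hg', one_mul]

lemma coeffs_sum_pow (n m : ℕ) (i : Fin 4) :
    ((coeffs n i).map (· ^ m)).sum = (gam (2 * n + 2) ^ m + conj (gam (2 * n + 2)) ^ m) *
      (gam (2 * n) ^ m + conj (gam (2 * n)) ^ m) := by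
  fin_cases i <;> refine (sum_pow_quad m).trans ?_ <;> ring

lemma coeffs_sum_pow_eq_zero {n : ℕ} (hn : 1 ≤ n) (i : Fin 4) :
    ((coeffs n i).map (· ^ (2 * n + 1))).sum = 0 := by
  rw [coeffs_sum_pow, gam_pow_succ_add_conj (by lia), mul_zero]

lemma coeffs_sum_pow_add_two_eq_zero (n : ℕ) (i : Fin 4) :
    ((coeffs n i).map (· ^ (2 * n + 1 + 2))).sum = 0 := by
  rw [coeffs_sum_pow, gam_pow_succ_add_conj (m := 2 * n + 2) (by lia), zero_mul]

lemma firstMoment_coeffs {n : ℕ} (hn : 1 ≤ n) (i : Fin 4) :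
    firstMoment (2 * n + 1) (coeffs n i) = ![1, -1, -1, 1] i * (gam (2 * n) ^ (2 * n + 1) / 2 *
      (gam (2 * n + 2) ^ (2 * n + 2) + conj (gam (2 * n + 2)) ^ (2 * n + 2))) := by
  have hp := gam_add_conj (2 * n + 2)
  have hg := gam_add_conj (2 * n)
  have hN := gam_pow_succ_add_conj (show 1 ≤ 2 * n by lia)
  have hp' := (add_comm _ _).trans hp
  have hg' := (add_comm _ _).trans hg
  have hN' := (add_comm _ _).trans hN
  have hk := eq_neg_of_add_eq_zero_right hN
  fin_cases i
  · exact (firstMoment_quad hp hg hN).trans (one_mul _).symm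
  · exact (firstMoment_quad hp hg' hN').trans (by rw [hk]; ring : _ = (-1 : ℂ) * _)
  · exact (firstMoment_quad hp' hg' hN').trans (by rw [hk]; ring : _ = (-1 : ℂ) * _)
  · exact (firstMoment_quad hp' hg hN).trans (by ring : _ = (1 : ℂ) * _)

lemma secondMoment_coeffs {n : ℕ} (hn : 1 ≤ n) (i : Fin 4) :
    secondMoment (2 * n + 1) (coeffs n i) = ![1, -1, 1, -1] i * (gam (2 * n) ^ (2 * n + 1) / 2 *
      (gam (2 * n + 2) * conj (gam (2 * n + 2)) *
        (gam (2 * n + 2) ^ (2 * n + 1) - conj (gam (2 * n + 2)) ^ (2 * n + 1)))) := by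
  have hp := gam_add_conj (2 * n + 2)
  have hg := gam_add_conj (2 * n)
  have hN := gam_pow_succ_add_conj (show 1 ≤ 2 * n by lia)
  have hN₂ := gam_pow_succ_add_conj (show 1 ≤ 2 * n + 2 by lia)
  have hp' := (add_comm _ _).trans hp
  have hg' := (add_comm _ _).trans hg
  have hN' := (add_comm _ _).trans hN
  have hN₂' := (add_comm _ _).trans hN₂
  have hk := eq_neg_of_add_eq_zero_right hN
  fin_cases i
  · exact (secondMoment_quad hp hg hN hN₂).trans (one_mul _).symm
  · exact (secondMoment_quad hp hg' hN' hN₂).trans (by rw [hk]; ring : _ = (-1 : ℂ) * _)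
  · exact (secondMoment_quad hp' hg' hN' hN₂').trans (by rw [hk]; ring : _ = (1 : ℂ) * _)
  · exact (secondMoment_quad hp' hg hN hN₂').trans (by ring : _ = (-1 : ℂ) * _)

end Coefficients

section FormalExponent

section SymmetricExponent

variable {𝕜 A : Type*} [Field 𝕜] [Ring A] [Algebra 𝕜 A] {N : ℕ} {x : A}

lemma ncSubst_neg (Z : A⟦X⟧) (f : 𝕜⟦X⟧) :
    ncSubst (-Z) f = ncSubst Z (PowerSeries.rescale (-1) f) := by
  ext m
  simp only [ncSubst, PowerSeries.coeff_mk]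
  refine Finset.sum_congr rfl fun k _ => ?_
  rw [PowerSeries.coeff_rescale]
  rcases Nat.even_or_odd k with hk | hk
  · rw [hk.neg_pow, hk.neg_one_pow, one_mul]
  · rw [hk.neg_pow, hk.neg_one_pow, map_neg, smul_neg, neg_one_mul, neg_smul]

variable [CharZero 𝕜]

lemma scaleHom_neg_one_ncSubst_exp_mul {Z : A⟦X⟧} (hZ : constantCoeff Z = 0)
    (hodd : scaleHom (-1 : 𝕜) Z = -Z) :
    scaleHom (-1 : 𝕜) (ncSubst Z (PowerSeries.exp 𝕜)) * ncSubst Z (PowerSeries.exp 𝕜) = 1 := by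
  rw [scaleHom_ncSubst, hodd, ncSubst_neg, ← ncSubst_mul hZ, mul_comm]
  exact (congrArg _ PowerSeries.exp_mul_exp_neg_eq_one).trans (ncSubst_one Z)

lemma exists_hasCenteredExpansion_ncSubst_exp (hN : 3 ≤ N) (hodd : Odd N) (G : A⟦X⟧)
    (hsym : scaleHom (-1 : 𝕜) (C x * X + X ^ N * G) = -(C x * X + X ^ N * G)) :
    ∃ W, HasCenteredExpansion N x (1 : 𝕜)
      (ncSubst (C x * X + X ^ N * G) (PowerSeries.exp 𝕜)) (coeff 0 G) 0 W := by
  have hexp := agreeBelow_ncSubst_exp (𝕜 := 𝕜) (show 2 ≤ N by lia) x G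
  obtain ⟨W, h⟩ := ((hexp.mono (by lia)).trans (agreeBelow_add_X_pow_mul _ _ _)
    ).exists_hasCenteredExpansion_of_symmetric hN hodd
      (scaleHom_neg_one_ncSubst_exp_mul (by simp [show N ≠ 0 by lia]) hsym)
  have hcoeff : coeff N (ncSubst (C x * X + X ^ N * G) (PowerSeries.exp 𝕜)) -
      coeff N (expSeries x (1 : 𝕜)) = coeff 0 G := by
    rw [hexp N (by lia), map_add, add_sub_cancel_left, PowerSeries.coeff_X_pow_mul',
      if_pos le_rfl, Nat.sub_self]
    simp
  exact ⟨W, hcoeff ▸ h⟩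

end SymmetricExponent

variable {n : ℕ}

lemma formalExp_eq_ncSubst (Z : OpSeries) : formalExp Z = ncSubst Z (PowerSeries.exp ℂ) := by
  ext m
  simp [formalExp, ncSubst, PowerSeries.coeff_exp]

lemma formalLog_eq_ncSubst (P : OpSeries) : formalLog P = ncSubst (P - 1) (PowerSeries.log ℂ) := by
  ext m
  rw [formalLog, ncSubst, PowerSeries.coeff_mk, PowerSeries.coeff_mk, Finset.range_eq_Ico,
    Finset.sum_eq_sum_Ico_succ_bot m.succ_pos, PowerSeries.coeff_log, if_pos rfl, zero_smul,
    zero_add]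
  refine Finset.sum_congr rfl fun k hk => ?_
  have hk₀ : k ≠ 0 := (Nat.succ_le_iff.mp (Finset.mem_Icc.mp hk).1).ne'
  rw [PowerSeries.coeff_log, if_neg hk₀]
  simp

lemma basicExponent_eq_scaleHom (n : ℕ) (a : ℂ) :
    basicExponent n a = scaleHom a (basicExponent n 1) := by
  ext m
  simp [basicExponent]

lemma exponent_eq_ncSubst (n : ℕ) (α : List ℂ) :
    exponent n α = ncSubst
      (compositionSeries (ncSubst (basicExponent n 1) (PowerSeries.exp ℂ)) α - 1)
      (PowerSeries.log ℂ) := by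
  rw [exponent, formalLog_eq_ncSubst, compositionSeries]
  simp only [formalExp_eq_ncSubst, scaleHom_ncSubst, ← basicExponent_eq_scaleHom]

lemma exists_basicExponent_eq (hn : 1 ≤ n) : ∃ G : OpSeries,
    basicExponent n 1 = C (Y 1) * X + X ^ (2 * n + 1) * G ∧ coeff 0 G = Y (2 * n + 1) := by
  have h : AgreeBelow (2 * n + 1) (basicExponent n 1) (C (Y 1) * X) := by
    intro k hk
    simp only [basicExponent, PowerSeries.coeff_mk, PowerSeries.coeff_C_mul, PowerSeries.coeff_X]
    split_ifs <;> first | lia | simp_all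
  obtain ⟨G, hG⟩ := h.exists_eq_add
  refine ⟨G, hG, ?_⟩
  have hcoeff := congrArg (coeff (2 * n + 1)) hG
  rw [map_add, PowerSeries.coeff_C_mul, PowerSeries.coeff_X, if_neg (by lia), mul_zero, zero_add,
    PowerSeries.coeff_X_pow_mul', if_pos le_rfl, Nat.sub_self] at hcoeff
  simpa [basicExponent] using hcoeff.symm

lemma scaleHom_neg_one_basicExponent (n : ℕ) :
    scaleHom (-1 : ℂ) (basicExponent n 1) = -basicExponent n 1 := by
  ext m
  rw [coeff_scaleHom, map_neg, basicExponent, PowerSeries.coeff_mk]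
  split_ifs with h
  · have hm : Odd m := by rcases h with rfl | ⟨h, -⟩; exacts [odd_one, h]
    rw [hm.neg_one_pow, neg_one_smul]
  · simp

lemma agreeBelow_exponent {n : ℕ} (hn : 1 ≤ n) {α : List ℂ} (hsum : α.sum = 1)
    (hpow : (α.map (· ^ (2 * n + 1))).sum = 0) (hpow₂ : (α.map (· ^ (2 * n + 1 + 2))).sum = 0) :
    AgreeBelow (2 * n + 4) (exponent n α) (C (Y 1) * X + X ^ (2 * n + 2) *
      (C (firstMoment (2 * n + 1) α • ⁅Y 1, Y (2 * n + 1)⁆) +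
        C ((secondMoment (2 * n + 1) α / 2) • ⁅Y 1, ⁅Y 1, Y (2 * n + 1)⁆⁆) * X)) := by
  have hN : 3 ≤ 2 * n + 1 := by lia
  obtain ⟨G, hG, hG₀⟩ := exists_basicExponent_eq hn
  obtain ⟨W, hW⟩ := exists_hasCenteredExpansion_ncSubst_exp hN (odd_two_mul_add_one n) G
    (hG ▸ scaleHom_neg_one_basicExponent n)
  have h := hW.compositionSeries hN α
  rw [hG₀, hsum, hpow, hpow₂, zero_smul, zero_smul, add_zero] at h
  rw [exponent_eq_ncSubst, hG]
  exact h.agreeBelow_log (by lia)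

lemma hasExpansion_of_moments {n : ℕ} (hn : 1 ≤ n) {α : List ℂ} (hsum : α.sum = 1)
    (hpow : (α.map (· ^ (2 * n + 1))).sum = 0) (hpow₂ : (α.map (· ^ (2 * n + 1 + 2))).sum = 0)
    {σ μ : ℝ} (hσ : firstMoment (2 * n + 1) α = Complex.I * σ)
    (hμ : secondMoment (2 * n + 1) α / 2 = μ) : HasExpansion n α 0 σ 0 μ := by
  have h := agreeBelow_exponent hn hsum hpow hpow₂
  rw [hσ, hμ] at h
  constructor
  · rw [h _ (by lia)]
    simp
  · rw [h _ (by lia), map_add, PowerSeries.coeff_X_pow_mul', if_neg (by lia)]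
    simp
  · intro k hk hk'
    rw [h _ (by lia), map_add, PowerSeries.coeff_X_pow_mul', if_neg (by lia)]
    simp [PowerSeries.coeff_X, show k ≠ 1 by lia]
  · rw [h _ (by lia), map_add, PowerSeries.coeff_X_pow_mul', if_neg (by lia)]
    simp [PowerSeries.coeff_C, show n ≠ 0 by lia]
  · rw [h _ (by lia), map_add, PowerSeries.coeff_X_pow_mul', if_pos le_rfl]
    simp
  · rw [h _ (by lia), map_add, PowerSeries.coeff_X_pow_mul', if_pos (by lia),
      show 2 * n + 3 - (2 * n + 2) = 1 by lia]
    simp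

theorem exists_hasExpansion {n : ℕ} (hn : 1 ≤ n) :
    ∃ σ₁ σ₂ μ : ℝ, μ ≠ 0 ∧ HasExpansion n (coeffs₁ n) 0 σ₁ 0 μ ∧
      HasExpansion n (coeffs₂ n) 0 σ₂ 0 (-μ) := by
  obtain ⟨r, hr, hg⟩ := exists_gam_pow_succ_eq (show 1 ≤ 2 * n by lia)
  have hp := gam_pow_im_pos (show 1 ≤ 2 * n + 1 by lia) (show 2 * n + 1 ≤ 2 * n + 2 by lia)
  have hfirst := firstMoment_coeffs hn
  have hsecond := secondMoment_coeffs hn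
  rw [hg, ← map_pow, Complex.add_conj] at hfirst
  rw [hg, ← map_pow, Complex.sub_conj, Complex.mul_conj] at hsecond
  set p := gam (2 * n + 2)
  have hp₀ : p ≠ 0 := fun h => by
    rw [h, zero_pow (by lia), Complex.zero_im] at hp
    exact hp.false
  have hpos : 0 < r / 2 * (Complex.normSq p * (p ^ (2 * n + 1)).im) := by
    have := Complex.normSq_pos.mpr hp₀
    positivity
  have hexp (i : Fin 4) {σ μ : ℝ} := hasExpansion_of_moments (σ := σ) (μ := μ) hn (coeffs_sum n i)
    (coeffs_sum_pow_eq_zero hn i) (coeffs_sum_pow_add_two_eq_zero n i)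
  refine ⟨r * (p ^ (2 * n + 2)).re, -(r * (p ^ (2 * n + 2)).re), _, (neg_lt_zero.mpr hpos).ne,
    hexp 0 ((hfirst 0).trans ?_) ?_, hexp 1 ((hfirst 1).trans ?_) ?_⟩
  · push_cast [Matrix.cons_val_zero]
    ring
  · rw [hsecond 0]
    push_cast [Matrix.cons_val_zero]
    linear_combination (r * Complex.normSq p * (p ^ (2 * n + 1)).im / 2 : ℂ) * Complex.I_sq
  · push_cast [Matrix.cons_val_one, Matrix.cons_val_zero]
    ring
  · rw [hsecond 1]
    push_cast [Matrix.cons_val_one, Matrix.cons_val_zero]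
    linear_combination (-r * Complex.normSq p * (p ^ (2 * n + 1)).im / 2 : ℂ) * Complex.I_sq

end FormalExponent

section Average

variable {A : Type*} [Ring A] [Algebra ℂ A] {n : ℕ} {x : A} {P : A⟦X⟧}

lemma hasCenteredExpansion_compositionSeries_coeffs (hn : 1 ≤ n)
    (hP : AgreeBelow (2 * n + 1) P (expSeries x (1 : ℂ))) (hsym : scaleHom (-1 : ℂ) P * P = 1) :
    ∃ Z, ∀ i, HasCenteredExpansion (2 * n + 1) x (1 : ℂ) (compositionSeries P (coeffs n i)) 0
      (firstMoment (2 * n + 1) (coeffs n i) • ⁅x, Z⁆)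
      ((secondMoment (2 * n + 1) (coeffs n i) / 2) • ⁅x, ⁅x, Z⁆⁆) := by
  have hN : 3 ≤ 2 * n + 1 := by lia
  obtain ⟨W, h⟩ := hP.exists_hasCenteredExpansion_of_symmetric hN (odd_two_mul_add_one n) hsym
  refine ⟨coeff (2 * n + 1) P - coeff (2 * n + 1) (expSeries x (1 : ℂ)), fun i => ?_⟩
  simpa only [coeffs_sum, coeffs_sum_pow_eq_zero hn, coeffs_sum_pow_add_two_eq_zero, zero_smul,
    add_zero] using h.compositionSeries hN (coeffs n i)

lemma agreeBelow_compositionSeries_coeffs (hn : 1 ≤ n)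
    (hP : AgreeBelow (2 * n + 1) P (expSeries x (1 : ℂ))) (hsym : scaleHom (-1 : ℂ) P * P = 1)
    (i : Fin 4) :
    AgreeBelow (2 * n + 2) (compositionSeries P (coeffs n i)) (expSeries x (1 : ℂ)) := by
  obtain ⟨Z, h⟩ := hasCenteredExpansion_compositionSeries_coeffs hn hP hsym
  exact (h i).agreeBelow_succ

lemma sum_fin_four_weights : ∑ _i : Fin 4, (1 / 4 : ℂ) = 1 := by norm_num

/-- The average of the power series of the four compositions of `T₂`. -/
def averageSeries (n : ℕ) (P : A⟦X⟧) : A⟦X⟧ :=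
  ∑ i, (1 / 4 : ℂ) • compositionSeries P (coeffs n i)

lemma averageSeries_symmetric (hn : 1 ≤ n)
    (hP : AgreeBelow (2 * n + 1) P (expSeries x (1 : ℂ))) (hsym : scaleHom (-1 : ℂ) P * P = 1) :
    AgreeBelow (4 * n + 4) (scaleHom (-1 : ℂ) (averageSeries n P) * averageSeries n P) 1 := by
  have hclose := agreeBelow_compositionSeries_coeffs hn hP hsym
  have h := AgreeBelow.symmetric_sum sum_fin_four_weights (σ := Equiv.addRight 2)
    (fun _ => rfl) (fun i j => (hclose i).trans (hclose j).symm) fun i => by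
      rw [Equiv.coe_addRight, ← coeffs_reverse]
      exact scaleHom_neg_one_compositionSeries_mul hsym (coeffs n i)
  exact h.mono (by lia)

lemma agreeBelow_averageSeries (hn : 1 ≤ n)
    (hP : AgreeBelow (2 * n + 1) P (expSeries x (1 : ℂ))) (hsym : scaleHom (-1 : ℂ) P * P = 1) :
    AgreeBelow (2 * n + 5) (averageSeries n P) (expSeries x (1 : ℂ)) := by
  obtain ⟨Z, h⟩ := hasCenteredExpansion_compositionSeries_coeffs hn hP hsym
  have hsum := HasCenteredExpansion.sum sum_fin_four_weights h
  have hfirst : ∑ i, (1 / 4 : ℂ) • firstMoment (2 * n + 1) (coeffs n i) • ⁅x, Z⁆ = 0 := by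
    simp [firstMoment_coeffs hn, Fin.sum_univ_four]
  have hsecond :
      ∑ i, (1 / 4 : ℂ) • (secondMoment (2 * n + 1) (coeffs n i) / 2) • ⁅x, ⁅x, Z⁆⁆ = 0 := by
    simp [secondMoment_coeffs hn, Fin.sum_univ_four, neg_div]
  simp only [smul_zero, Finset.sum_const_zero, hfirst, hsecond] at hsum
  exact hsum.agreeBelow_add_three.succ_of_symmetric ⟨n + 2, by lia⟩ (by lia) (by lia)
    (averageSeries_symmetric hn hP hsym)

end Average

section Taylor

variable {E : Type*} [NormedAddCommGroup E] {x : E}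

lemma isBigO_fst_pow_of_le {j k : ℕ} (h : k ≤ j) :
    (fun p : ℂ × E => p.1 ^ j) =O[𝓝 (0, x)] fun p => p.1 ^ k := by
  have hcont : Continuous fun p : ℂ × E => p.1 ^ (j - k) := by fun_prop
  have hbounded := (hcont.tendsto (0, x)).isBigO_one ℂ
  simpa only [mul_one, ← pow_add, Nat.add_sub_cancel' h] using
    (isBigO_refl (fun p : ℂ × E => p.1 ^ k) (𝓝 (0, x))).mul hbounded

lemma isBigO_pow_succ_of_hasDerivAt {R R' : ℂ × E → ℂ} {K : ℕ} (h0 : ∀ y, R (0, y) = 0)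
    (hR : ∀ᶠ p in 𝓝 (0, x), HasDerivAt (fun h => R (h, p.2)) (R' p) p.1)
    (hR' : R' =O[𝓝 (0, x)] fun p => p.1 ^ K) : R =O[𝓝 (0, x)] fun p => p.1 ^ (K + 1) := by
  obtain ⟨B, hB, hbound⟩ := hR'.exists_nonneg
  obtain ⟨ε, hε, hball⟩ := Metric.eventually_nhds_iff_ball.mp (hR.and hbound.bound)
  refine IsBigO.of_bound B ?_
  filter_upwards [Metric.ball_mem_nhds _ hε] with p hp
  have hmem : ∀ z ∈ Metric.closedBall (0 : ℂ) ‖p.1‖, (z, p.2) ∈ Metric.ball (0, x) ε := by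
    intro z hz
    rw [mem_closedBall_zero_iff] at hz
    rw [Metric.mem_ball, Prod.dist_eq, dist_zero_right, max_lt_iff] at hp ⊢
    exact ⟨hz.trans_lt hp.1, hp.2⟩
  have hderiv : ∀ z ∈ Metric.closedBall (0 : ℂ) ‖p.1‖, ‖R' (z, p.2)‖ ≤ B * ‖p.1‖ ^ K := by
    intro z hz
    refine (hball _ (hmem z hz)).2.trans ?_
    rw [norm_pow]
    gcongr
    exact mem_closedBall_zero_iff.mp hz
  have hmean := (convex_closedBall (0 : ℂ) ‖p.1‖).norm_image_sub_le_of_norm_hasDerivWithin_le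
    (f := fun h => R (h, p.2)) (fun z hz => (hball _ (hmem z hz)).1.hasDerivWithinAt) hderiv
    (Metric.mem_closedBall_self (norm_nonneg _)) (mem_closedBall_zero_iff.mpr le_rfl)
  simpa only [h0, sub_zero, norm_pow, pow_succ, norm_mul, mul_assoc] using hmean

lemma hasDerivAt_sum_pow_div_factorial (c : ℕ → ℂ) (K : ℕ) (h : ℂ) :
    HasDerivAt (fun h : ℂ => ∑ k ∈ Finset.range (K + 1), h ^ k * ((k.factorial : ℂ)⁻¹ * c k))
      (∑ k ∈ Finset.range K, h ^ k * ((k.factorial : ℂ)⁻¹ * c (k + 1))) h := by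
  have hsum := HasDerivAt.fun_sum (u := Finset.range (K + 1)) fun k _ =>
    (hasDerivAt_pow k h).mul_const ((k.factorial : ℂ)⁻¹ * c k)
  refine hsum.congr_deriv ?_
  rw [Finset.sum_range_succ', Nat.cast_zero, zero_mul, zero_mul, add_zero]
  refine Finset.sum_congr rfl fun k _ => ?_
  rw [Nat.factorial_succ]
  push_cast
  have : (k : ℂ) + 1 ≠ 0 := k.cast_add_one_ne_zero
  field_simp

variable [NormedSpace ℂ E]

lemma hasDerivAt_deriv_fst {G : ℂ × E → ℂ} {p : ℂ × E} (hG : AnalyticAt ℂ G p) :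
    HasDerivAt (fun h => G (h, p.2)) (fderiv ℂ G p (1, 0)) p.1 :=
  HasFDerivAt.comp_hasDerivAt (f := fun h : ℂ => (h, p.2)) p.1
    hG.differentiableAt.hasFDerivAt ((hasDerivAt_id p.1).prodMk (hasDerivAt_const p.1 p.2))

lemma analyticAt_deriv_fst {G : ℂ × E → ℂ} {p : ℂ × E} (hG : AnalyticAt ℂ G p) :
    AnalyticAt ℂ (fun q => deriv (fun h => G (h, q.2)) q.1) p := by
  have hfderiv : AnalyticAt ℂ (fun q => fderiv ℂ G q (1, 0)) p :=
    ((ContinuousLinearMap.apply ℂ ℂ ((1, 0) : ℂ × E)).analyticAt _).comp hG.fderiv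
  refine hfderiv.congr ?_
  filter_upwards [hG.eventually_analyticAt] with q hq
  exact (hasDerivAt_deriv_fst hq).deriv.symm

lemma analyticAt_iteratedDeriv_fst (k : ℕ) {G : ℂ × E → ℂ} {p : ℂ × E} (hG : AnalyticAt ℂ G p) :
    AnalyticAt ℂ (fun q => iteratedDeriv k (fun h => G (h, q.2)) q.1) p := by
  induction k generalizing G with
  | zero => simpa only [iteratedDeriv_zero] using hG
  | succ k ih =>
    simp only [iteratedDeriv_succ']
    exact ih (analyticAt_deriv_fst hG)

/-- The Taylor polynomial of degree less than `K` in the first variable, at the origin. -/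
def taylorFst (K : ℕ) (G : ℂ × E → ℂ) (p : ℂ × E) : ℂ :=
  ∑ k ∈ Finset.range K,
    p.1 ^ k * ((k.factorial : ℂ)⁻¹ * iteratedDeriv k (fun h => G (h, p.2)) 0)

lemma sub_taylorFst_isBigO (K : ℕ) {G : ℂ × E → ℂ} (hG : AnalyticAt ℂ G (0, x)) :
    (fun p => G p - taylorFst K G p) =O[𝓝 (0, x)] fun p => p.1 ^ K := by
  induction K generalizing G with
  | zero =>
    simpa only [taylorFst, Finset.range_zero, Finset.sum_empty, sub_zero, pow_zero]
      using hG.continuousAt.isBigO_one ℂ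
  | succ K ih =>
    refine isBigO_pow_succ_of_hasDerivAt (fun y => ?_) ?_ (ih (analyticAt_deriv_fst hG))
    · simp [taylorFst, Finset.sum_range_succ']
    · filter_upwards [hG.eventually_analyticAt] with p hp
      refine (hasDerivAt_deriv_fst hp).differentiableAt.hasDerivAt.sub ?_
      simpa only [taylorFst, iteratedDeriv_succ'] using hasDerivAt_sum_pow_div_factorial
        (fun k => iteratedDeriv k (fun h => G (h, p.2)) 0) K p.1

lemma eq_zero_of_sum_pow_isBigO {K : ℕ} {c : ℕ → ℂ}
    (h : (fun z : ℂ => ∑ k ∈ Finset.range K, z ^ k * c k) =O[𝓝[≠] 0] fun z => z ^ K) :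
    ∀ k < K, c k = 0 := by
  induction K generalizing c with
  | zero => exact fun k hk => absurd hk k.not_lt_zero
  | succ K ih =>
    have hc0 : c 0 = 0 := by
      have hcont : Continuous fun z : ℂ => ∑ k ∈ Finset.range (K + 1), z ^ k * c k := by fun_prop
      have hlim : Tendsto (fun z : ℂ => ∑ k ∈ Finset.range (K + 1), z ^ k * c k) (𝓝[≠] 0)
          (𝓝 (c 0)) :=
        (hcont.tendsto' 0 _ (by simp [Finset.sum_range_succ'])).mono_left nhdsWithin_le_nhds
      have hpow : Tendsto (fun z : ℂ => z ^ (K + 1)) (𝓝[≠] 0) (𝓝 0) :=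
        ((continuous_pow (K + 1)).tendsto' 0 _ (zero_pow K.succ_ne_zero)).mono_left
          nhdsWithin_le_nhds
      exact tendsto_nhds_unique hlim (h.trans_tendsto hpow)
    have hshift : (fun z : ℂ => ∑ k ∈ Finset.range K, z ^ k * c (k + 1)) =O[𝓝[≠] 0]
        fun z => z ^ K := by
      refine (h.mul (isBigO_refl (fun z : ℂ => z⁻¹) _)).congr' ?_ ?_
      · filter_upwards [self_mem_nhdsWithin] with z hz
        rw [Finset.sum_range_succ', hc0, mul_zero, add_zero, Finset.sum_mul]
        refine Finset.sum_congr rfl fun k _ => ?_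
        rw [pow_succ, mul_right_comm, mul_inv_cancel_right₀ hz]
      · filter_upwards [self_mem_nhdsWithin] with z hz
        rw [pow_succ, mul_inv_cancel_right₀ hz]
    rintro (_ | k) hk
    exacts [hc0, ih hshift k (Nat.lt_of_succ_lt_succ hk)]

lemma sub_linearization_isBigO {g : E → ℂ} (hg : AnalyticAt ℂ g x) :
    (fun q : E × E => g q.1 - g q.2 - fderiv ℂ g q.2 (q.1 - q.2)) =O[𝓝 (x, x)]
      fun q => ‖q.1 - q.2‖ ^ 2 := by
  obtain ⟨L, s, hs, hL⟩ := (hg.fderiv.contDiffAt (n := 1)).exists_lipschitzOnWith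
  obtain ⟨ε, hε, hball⟩ := Metric.mem_nhds_iff.mp (inter_mem hs hg.eventually_analyticAt)
  refine IsBigO.of_bound L ?_
  filter_upwards [prod_mem_nhds (Metric.ball_mem_nhds x hε) (Metric.ball_mem_nhds x hε)]
    with q hq
  have hseg : segment ℝ q.2 q.1 ⊆ Metric.ball x ε := (convex_ball x ε).segment_subset hq.2 hq.1
  have hlip : ∀ z ∈ segment ℝ q.2 q.1, ‖fderiv ℂ g z - fderiv ℂ g q.2‖ ≤ L * ‖q.1 - q.2‖ := by
    intro z hz
    refine (hL.norm_sub_le (hball (hseg hz)).1 (hball hq.2).1).trans ?_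
    gcongr
    exact norm_sub_le_of_mem_segment hz
  have hmean := (convex_segment (𝕜 := ℝ) q.2 q.1).norm_image_sub_le_of_norm_hasFDerivWithin_le'
    (𝕜 := ℂ)
    (fun z hz => ((hball (hseg hz)).2.differentiableAt.hasFDerivAt).hasFDerivWithinAt) hlip
    (left_mem_segment ℝ _ _) (right_mem_segment ℝ _ _)
  rwa [Real.norm_of_nonneg (by positivity), sq, ← mul_assoc]

/-- The first-order errors cancel because the weights sum to `1`. -/
lemma sum_mul_apply_sub_apply_sum_isBigO {ι α : Type*} [Fintype ι] {l : Filter α} {w : ι → ℂ}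
    (hw : ∑ i, w i = 1) {ψ : ι → α → E} {u : α → ℂ} (hψ : ∀ i, Tendsto (ψ i) l (𝓝 x))
    (hclose : ∀ i j, (fun a => ψ i a - ψ j a) =O[l] u) {g : E → ℂ} (hg : AnalyticAt ℂ g x) :
    (fun a => ∑ i, w i * g (ψ i a) - g (∑ i, w i • ψ i a)) =O[l] fun a => u a ^ 2 := by
  set T : α → E := fun a => ∑ i, w i • ψ i a
  have hT : Tendsto T l (𝓝 x) := by
    simpa only [← Finset.sum_smul, hw, one_smul] using
      tendsto_finsetSum Finset.univ fun i _ => (hψ i).const_smul (w i)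
  have hdist (i : ι) : (fun a => ψ i a - T a) =O[l] u := by
    refine (IsBigO.fun_sum fun j (_ : j ∈ Finset.univ) =>
      (hclose i j).const_smul_left (w j)).congr_left fun a => ?_
    simp only [T, Pi.smul_apply, smul_sub, Finset.sum_sub_distrib, ← Finset.sum_smul, hw, one_smul]
  have hlin (i : ι) :
      (fun a => g (ψ i a) - g (T a) - fderiv ℂ g (T a) (ψ i a - T a)) =O[l] fun a => u a ^ 2 :=
    ((sub_linearization_isBigO hg).comp_tendsto ((hψ i).prodMk_nhds hT)).trans
      ((hdist i).norm_left.pow 2)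
  refine (IsBigO.fun_sum fun i (_ : i ∈ Finset.univ) =>
    (hlin i).const_mul_left (w i)).congr_left fun a => ?_
  have hcancel : ∑ i, w i * fderiv ℂ g (T a) (ψ i a - T a) = 0 := by
    simp_rw [← smul_eq_mul, ← map_smul, ← map_sum, smul_sub, Finset.sum_sub_distrib,
      ← Finset.sum_smul, hw, one_smul]
    rw [sub_self, map_zero]
  simp only [mul_sub, Finset.sum_sub_distrib, ← Finset.sum_mul, hw, one_mul] at hcancel ⊢
  rw [hcancel, sub_zero]

end Taylor

/-! ### Operators on holomorphic functions -/

section Operators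

variable {E : Type*} [NormedAddCommGroup E] [NormedSpace ℂ E] {U : Set E} {x : E} {K : ℕ}

/-- The functions that are holomorphic on `U`, normalized to vanish off `U` so that a function is
determined by its values on `U`. -/
def holo (U : Set E) : Submodule ℂ (E → ℂ) where
  carrier := {g | AnalyticOnNhd ℂ g U ∧ ∀ x ∉ U, g x = 0}
  add_mem' hf hg :=
    ⟨hf.1.add hg.1, fun x hx => by rw [Pi.add_apply, hf.2 x hx, hg.2 x hx, add_zero]⟩
  zero_mem' := ⟨analyticOnNhd_const, fun _ _ => rfl⟩
  smul_mem' c g hg :=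
    ⟨fun x hx => analyticAt_const.smul (hg.1 x hx), fun x hx => by
      rw [Pi.smul_apply, hg.2 x hx, smul_zero]⟩

instance : CoeFun (holo U) fun _ => E → ℂ := ⟨Subtype.val⟩

namespace holo

lemma analyticAt (g : holo U) (hx : x ∈ U) : AnalyticAt ℂ g x := g.2.1 x hx

lemma ext_on {f g : holo U} (h : ∀ x ∈ U, f x = g x) : f = g := by
  ext x
  by_cases hx : x ∈ U
  exacts [h x hx, (f.2.2 x hx).trans (g.2.2 x hx).symm]

/-- The holomorphic function that agrees with `g` on `U`. -/
def ofAnalyticOnNhd (hU : IsOpen U) (g : E → ℂ) (hg : AnalyticOnNhd ℂ g U) : holo U :=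
  ⟨U.indicator g, fun x hx => (hg x hx).congr <| by
    filter_upwards [hU.mem_nhds hx] with y hy
    rw [Set.indicator_of_mem hy], fun _ hx => Set.indicator_of_notMem hx g⟩

lemma ofAnalyticOnNhd_apply (hU : IsOpen U) {g : E → ℂ} (hg : AnalyticOnNhd ℂ g U)
    (hx : x ∈ U) : ofAnalyticOnNhd hU g hg x = g x :=
  Set.indicator_of_mem hx g

lemma add_apply (f g : holo U) (x : E) : (f + g) x = f x + g x := rfl

lemma smul_apply (c : ℂ) (g : holo U) (x : E) : (c • g) x = c * g x := rfl

end holo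

/-- The truncation `∑_{k < K} h ^ k (P_k g)(y)` of an operator series `P = ∑ h ^ k P_k` applied to
`g`, as a function of `(h, y)`. -/
def partialSum (K : ℕ) (P : (Module.End ℂ (holo U))⟦X⟧) (g : holo U) (p : ℂ × E) : ℂ :=
  ∑ k ∈ Finset.range K, p.1 ^ k * coeff k P g p.2

section partialSum

variable {P Q : (Module.End ℂ (holo U))⟦X⟧}

lemma AgreeBelow.partialSum_eq (h : AgreeBelow K P Q) : partialSum K P = partialSum K Q := by
  funext g p
  exact Finset.sum_congr rfl fun k hk => by rw [h k (Finset.mem_range.mp hk)]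

lemma partialSum_scaleHom (a : ℂ) (P : (Module.End ℂ (holo U))⟦X⟧) (g : holo U) (p : ℂ × E) :
    partialSum K (scaleHom a P) g p = partialSum K P g (a * p.1, p.2) := by
  refine Finset.sum_congr rfl fun k _ => ?_
  rw [coeff_scaleHom a P k, mul_pow, mul_comm (a ^ k), mul_assoc]
  rfl

lemma partialSum_one (g : holo U) (p : ℂ × E) : partialSum (K + 1) 1 g p = g p.2 := by
  simp [partialSum, Finset.sum_range_succ', PowerSeries.coeff_one]

lemma partialSum_sum_smul {ι : Type*} [Fintype ι] (w : ι → ℂ)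
    (R : ι → (Module.End ℂ (holo U))⟦X⟧) (g : holo U) (p : ℂ × E) :
    partialSum K (∑ i, w i • R i) g p = ∑ i, w i * partialSum K (R i) g p := by
  simp only [partialSum, map_sum, PowerSeries.coeff_smul, LinearMap.sum_apply,
    LinearMap.smul_apply, Submodule.coe_sum, Submodule.coe_smul, Finset.sum_apply, Pi.smul_apply,
    smul_eq_mul, Finset.mul_sum, mul_left_comm]
  exact Finset.sum_comm

lemma partialSum_mul (P Q : (Module.End ℂ (holo U))⟦X⟧) (g : holo U) (p : ℂ × E) :
    partialSum K (P * Q) g p =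
      ∑ k ∈ Finset.range K, p.1 ^ k * partialSum (K - k) P (coeff k Q g) p := by
  have hcoeff (m : ℕ) : p.1 ^ m * coeff m (P * Q) g p.2 = ∑ k ∈ Finset.range (m + 1),
      p.1 ^ k * (p.1 ^ (m - k) * coeff (m - k) P (coeff k Q g) p.2) := by
    rw [PowerSeries.coeff_mul, ← Finset.Nat.sum_antidiagonal_swap,
      Finset.Nat.sum_antidiagonal_eq_sum_range_succ_mk, LinearMap.sum_apply, Submodule.coe_sum,
      Finset.sum_apply, Finset.mul_sum]
    refine Finset.sum_congr rfl fun k hk => ?_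
    rw [← mul_assoc, ← pow_add, Nat.add_sub_cancel' (Nat.lt_succ_iff.mp (Finset.mem_range.mp hk))]
    rfl
  simp only [partialSum, hcoeff, Finset.mul_sum]
  exact Finset.sum_range_diag_flip K fun k l => p.1 ^ k * (p.1 ^ l * coeff l P (coeff k Q g) p.2)

lemma isBigO_one_snd (g : holo U) (hx : x ∈ U) :
    (fun p : ℂ × E => g p.2) =O[𝓝 (0, x)] fun _ => (1 : ℂ) :=
  ((holo.analyticAt g hx).continuousAt.tendsto.comp
    (continuous_snd.tendsto ((0 : ℂ), x))).isBigO_one ℂ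

lemma partialSum_sub_partialSum_isBigO {L : ℕ} (hL : L ≤ K) (P : (Module.End ℂ (holo U))⟦X⟧)
    (g : holo U) (hx : x ∈ U) :
    (fun p => partialSum K P g p - partialSum L P g p) =O[𝓝 (0, x)] fun p => p.1 ^ L := by
  have hterm : ∀ k ∈ Finset.Ico L K, (fun p : ℂ × E => p.1 ^ k * coeff k P g p.2)
      =O[𝓝 (0, x)] fun p => p.1 ^ L := fun k hk => by
    simpa only [mul_one] using
      (isBigO_fst_pow_of_le (Finset.mem_Ico.mp hk).1).mul (isBigO_one_snd (coeff k P g) hx)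
  refine (IsBigO.fun_sum hterm).congr_left fun p => ?_
  rw [partialSum, ← Finset.sum_range_add_sum_Ico _ hL, partialSum, add_sub_cancel_left]

lemma agreeBelow_of_isBigO (h : ∀ x ∈ U, ∀ g : holo U,
    (fun h : ℂ => partialSum K P g (h, x) - partialSum K Q g (h, x)) =O[𝓝 0] fun h => h ^ K) :
    AgreeBelow K P Q := by
  refine fun k hk => LinearMap.ext fun g => holo.ext_on fun x hx => sub_eq_zero.mp ?_
  refine eq_zero_of_sum_pow_isBigO (c := fun k => coeff k P g x - coeff k Q g x)
    (((h x hx g).mono nhdsWithin_le_nhds).congr_left fun z => ?_) k hk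
  simp only [partialSum, mul_sub, Finset.sum_sub_distrib]

end partialSum

/-- `P` is the series of the operators `g ↦ g ∘ M h` up to `O(h ^ K)`, locally uniformly on `U`. -/
structure HasSeries (U : Set E) (K : ℕ) (M : ℂ → E → E) (P : (Module.End ℂ (holo U))⟦X⟧) :
    Prop where
  tendsto : ∀ x ∈ U, Tendsto (fun p : ℂ × E => M p.1 p.2) (𝓝 (0, x)) (𝓝 x)
  isBigO : ∀ x ∈ U, ∀ g : holo U,
    (fun p : ℂ × E => g (M p.1 p.2) - partialSum K P g p) =O[𝓝 (0, x)] fun p => p.1 ^ K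

namespace HasSeries

variable {M N : ℂ → E → E} {P Q : (Module.End ℂ (holo U))⟦X⟧}

lemma mono (hM : HasSeries U K M P) {L : ℕ} (hL : L ≤ K) : HasSeries U L M P := by
  refine ⟨hM.tendsto, fun x hx g => ?_⟩
  refine (((hM.isBigO x hx g).trans (isBigO_fst_pow_of_le hL)).add
    (partialSum_sub_partialSum_isBigO hL P g hx)).congr_left fun p => ?_
  ring

lemma scale (hM : HasSeries U K M P) (a : ℂ) :
    HasSeries U K (fun h => M (a * h)) (scaleHom a P) := by
  have hT (x : E) : Tendsto (fun p : ℂ × E => (a * p.1, p.2)) (𝓝 (0, x)) (𝓝 (0, x)) :=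
    Continuous.tendsto' (by fun_prop) _ _ (by rw [mul_zero])
  refine ⟨fun x hx => (hM.tendsto x hx).comp (hT x), fun x hx g => ?_⟩
  have hpow : (fun p : ℂ × E => (a * p.1) ^ K) =O[𝓝 (0, x)] fun p => p.1 ^ K := by
    simpa only [mul_pow] using
      (isBigO_refl (fun p : ℂ × E => p.1 ^ K) (𝓝 (0, x))).const_mul_left (a ^ K)
  simpa only [partialSum_scaleHom, Function.comp_def] using
    ((hM.isBigO x hx g).comp_tendsto (hT x)).trans hpow

protected lemma id (K : ℕ) : HasSeries U K (fun _ => id) 1 := by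
  refine .mono ⟨fun x _ => continuous_snd.tendsto' _ _ rfl, fun x _ g => ?_⟩ K.le_succ
  simpa only [partialSum_one, id_eq, sub_self] using isBigO_zero _ _

/-- The order of the factors is reversed because `M ↦ (g ↦ g ∘ M)` is contravariant. -/
lemma comp (hM : HasSeries U K M P) (hN : HasSeries U K N Q) :
    HasSeries U K (fun h => M h ∘ N h) (Q * P) := by
  have hT (x) (hx : x ∈ U) : Tendsto (fun p : ℂ × E => (p.1, N p.1 p.2)) (𝓝 (0, x)) (𝓝 (0, x)) :=
    (continuous_fst.tendsto' _ _ rfl).prodMk_nhds (hN.tendsto x hx)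
  refine ⟨fun x hx => (hM.tendsto x hx).comp (hT x hx), fun x hx g => ?_⟩
  have houter := (hM.isBigO x hx g).comp_tendsto (hT x hx)
  have hinner : ∀ k ∈ Finset.range K, (fun p : ℂ × E => p.1 ^ k *
      (coeff k P g (N p.1 p.2) - partialSum (K - k) Q (coeff k P g) p)) =O[𝓝 (0, x)]
      fun p => p.1 ^ K := fun k hk => by
    simpa only [← pow_add, Nat.add_sub_cancel' (Finset.mem_range.mp hk).le] using
      (isBigO_refl (fun p : ℂ × E => p.1 ^ k) (𝓝 (0, x))).mul
        ((hN.mono (K.sub_le k)).isBigO x hx (coeff k P g))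
  refine (houter.add (IsBigO.fun_sum hinner)).congr_left fun p => ?_
  simp only [partialSum_mul, mul_sub, Finset.sum_sub_distrib, Function.comp_apply]
  exact sub_add_sub_cancel _ _ _

lemma isBigO_at (hM : HasSeries U K M P) (hx : x ∈ U) (g : holo U) :
    (fun h : ℂ => g (M h x) - partialSum K P g (h, x)) =O[𝓝 0] fun h => h ^ K :=
  (hM.isBigO x hx g).comp_tendsto (k := fun h : ℂ => (h, x))
    (Continuous.tendsto' (by fun_prop) _ _ rfl)

lemma tendsto_at (hM : HasSeries U K M P) (hx : x ∈ U) : Tendsto (fun h => M h x) (𝓝 0) (𝓝 x) :=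
  (hM.tendsto x hx).comp (Continuous.tendsto' (f := fun h : ℂ => (h, x)) (by fun_prop) _ _ rfl)

end HasSeries

section TaylorOperator

variable {S : ℂ → E → E}

lemma analyticAt_holo_comp (hS : ∀ x ∈ U, AnalyticAt ℂ (fun p : ℂ × E => S p.1 p.2) (0, x))
    (h0 : ∀ x ∈ U, S 0 x = x) (g : holo U) (hx : x ∈ U) :
    AnalyticAt ℂ (fun p : ℂ × E => g (S p.1 p.2)) (0, x) :=
  AnalyticAt.fun_comp (by simpa only [h0 x hx] using holo.analyticAt g hx) (hS x hx)

lemma analyticOnNhd_taylorCoeff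
    (hS : ∀ x ∈ U, AnalyticAt ℂ (fun p : ℂ × E => S p.1 p.2) (0, x))
    (h0 : ∀ x ∈ U, S 0 x = x) (k : ℕ) (g : holo U) : AnalyticOnNhd ℂ
      (fun x => (k.factorial : ℂ)⁻¹ * iteratedDeriv k (fun h => g (S h x)) 0) U := fun _ hx =>
  analyticAt_const.mul <| AnalyticAt.fun_comp
    (analyticAt_iteratedDeriv_fst k (analyticAt_holo_comp hS h0 g hx))
    (analyticAt_const.prod analyticAt_id)

/-- The `k`-th Taylor coefficient at `h = 0` of `g ↦ g ∘ S h`, as an operator on `holo U`. -/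
def taylorOperator (hU : IsOpen U)
    (hS : ∀ x ∈ U, AnalyticAt ℂ (fun p : ℂ × E => S p.1 p.2) (0, x))
    (h0 : ∀ x ∈ U, S 0 x = x) (k : ℕ) : Module.End ℂ (holo U) where
  toFun g := holo.ofAnalyticOnNhd hU
    (fun x => (k.factorial : ℂ)⁻¹ * iteratedDeriv k (fun h => g (S h x)) 0)
    (analyticOnNhd_taylorCoeff hS h0 k g)
  map_add' f g := holo.ext_on fun x hx => by
    have hsmooth (g : holo U) : ContDiffAt ℂ k (fun h => g (S h x)) 0 :=
      (AnalyticAt.fun_comp (g := fun p : ℂ × E => g (S p.1 p.2)) (f := fun h => (h, x))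
        (analyticAt_holo_comp hS h0 g hx) (analyticAt_id.prod analyticAt_const)).contDiffAt
    simp only [holo.add_apply, holo.ofAnalyticOnNhd_apply _ _ hx,
      iteratedDeriv_fun_add (hsmooth f) (hsmooth g), mul_add]
  map_smul' c g := holo.ext_on fun x hx => by
    simp only [holo.smul_apply, holo.ofAnalyticOnNhd_apply _ _ hx,
      iteratedDeriv_const_mul_field, RingHom.id_apply, mul_left_comm]

lemma exists_hasSeries (hU : IsOpen U)
    (hS : ∀ x ∈ U, AnalyticAt ℂ (fun p : ℂ × E => S p.1 p.2) (0, x))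
    (h0 : ∀ x ∈ U, S 0 x = x) :
    ∃ P : (Module.End ℂ (holo U))⟦X⟧, ∀ K, HasSeries U K S P := by
  refine ⟨PowerSeries.mk (taylorOperator hU hS h0), fun K => ⟨fun x hx => ?_, fun x hx g => ?_⟩⟩
  · simpa only [ContinuousAt, h0 x hx] using (hS x hx).continuousAt
  · refine (sub_taylorFst_isBigO K (analyticAt_holo_comp hS h0 g hx)).congr' ?_ .rfl
    filter_upwards [(continuous_snd.tendsto ((0 : ℂ), x)).eventually (hU.mem_nhds hx)] with p hp
    refine congrArg _ (Finset.sum_congr rfl fun k _ => ?_)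
    rw [PowerSeries.coeff_mk]
    exact congrArg _ (holo.ofAnalyticOnNhd_apply hU (analyticOnNhd_taylorCoeff hS h0 k g) hp).symm

end TaylorOperator

lemma analyticOnNhd_fderiv_apply {f : E → E} (hf : AnalyticOnNhd ℂ f U) (g : holo U) :
    AnalyticOnNhd ℂ (fun x => fderiv ℂ g x (f x)) U := fun x hx =>
  AnalyticAt.comp (g := fun q : (E →L[ℂ] ℂ) × E => q.1 q.2)
    ((ContinuousLinearMap.id ℂ (E →L[ℂ] ℂ)).analyticAt_bilinear _)
    ((holo.analyticAt g hx).fderiv.prod (hf x hx))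

/-- The Lie derivative along `f`. -/
def lieDeriv (hU : IsOpen U) {f : E → E} (hf : AnalyticOnNhd ℂ f U) : Module.End ℂ (holo U) where
  toFun g := holo.ofAnalyticOnNhd hU (fun x => fderiv ℂ g x (f x))
    (analyticOnNhd_fderiv_apply hf g)
  map_add' g k := holo.ext_on fun x hx => by
    simp only [holo.add_apply, holo.ofAnalyticOnNhd_apply _ _ hx, Submodule.coe_add,
      fderiv_add (holo.analyticAt g hx).differentiableAt (holo.analyticAt k hx).differentiableAt,
      add_apply]
  map_smul' c g := holo.ext_on fun x hx => by
    simp only [holo.smul_apply, holo.ofAnalyticOnNhd_apply _ _ hx, Submodule.coe_smul,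
      fderiv_const_smul (holo.analyticAt g hx).differentiableAt, smul_apply, smul_eq_mul,
      RingHom.id_apply]

lemma lieDeriv_apply (hU : IsOpen U) {f : E → E} (hf : AnalyticOnNhd ℂ f U) (g : holo U)
    (hx : x ∈ U) : lieDeriv hU hf g x = fderiv ℂ g x (f x) :=
  holo.ofAnalyticOnNhd_apply hU (analyticOnNhd_fderiv_apply hf g) hx

end Operators

section Order

variable {d : ℕ} {U : Set (Fin d → ℂ)} {x : Fin d → ℂ} {K : ℕ}

/-- The `i`-th coordinate, as an element of `holo U`. -/
def coord (hU : IsOpen U) (i : Fin d) : holo U :=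
  holo.ofAnalyticOnNhd hU (fun x => x i) fun x _ =>
    (ContinuousLinearMap.proj (R := ℂ) (φ := fun _ : Fin d => ℂ) i).analyticAt x

lemma coord_apply (hU : IsOpen U) (i : Fin d) (hx : x ∈ U) : coord hU i x = x i :=
  Set.indicator_of_mem hx fun x => x i

lemma isBigO_sub_of_holo {α : Type*} {l : Filter α} {M N : α → Fin d → ℂ} {u : α → ℂ}
    (hU : IsOpen U) (hx : x ∈ U) (hM : Tendsto M l (𝓝 x)) (hN : Tendsto N l (𝓝 x))
    (h : ∀ g : holo U, (fun a => g (M a) - g (N a)) =O[l] u) :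
    (fun a => M a - N a) =O[l] u := by
  refine isBigO_pi.mpr fun i => (h (coord hU i)).congr' ?_ .rfl
  filter_upwards [hM.eventually (hU.mem_nhds hx), hN.eventually (hU.mem_nhds hx)] with a hMa hNa
  rw [coord_apply hU i hMa, coord_apply hU i hNa, Pi.sub_apply]

namespace HasSeries

variable {M N : ℂ → (Fin d → ℂ) → Fin d → ℂ} {P Q : (Module.End ℂ (holo U))⟦X⟧}

lemma sub_isBigO (hU : IsOpen U) (hM : HasSeries U K M P) (hN : HasSeries U K N Q)
    (hPQ : AgreeBelow K P Q) (hx : x ∈ U) :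
    (fun p : ℂ × (Fin d → ℂ) => M p.1 p.2 - N p.1 p.2) =O[𝓝 (0, x)] fun p => p.1 ^ K := by
  refine isBigO_sub_of_holo hU hx (hM.tendsto x hx) (hN.tendsto x hx) fun g => ?_
  refine ((hM.isBigO x hx g).sub (hN.isBigO x hx g)).congr_left fun p => ?_
  rw [hPQ.partialSum_eq, sub_sub_sub_cancel_right]

lemma composition {S : ℂ → (Fin d → ℂ) → Fin d → ℂ} (hS : HasSeries U K S P) :
    ∀ α : List ℂ, HasSeries U K (composition S α) (compositionSeries P α)
  | [] => .id K
  | a :: α => by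
    rw [compositionSeries_cons]
    exact (hS.scale a).comp (hS.composition α)

lemma sum_smul {ι : Type*} [Fintype ι] {m : ℕ} {w : ι → ℂ} (hw : ∑ i, w i = 1)
    {ψ : ι → ℂ → (Fin d → ℂ) → Fin d → ℂ} {R : ι → (Module.End ℂ (holo U))⟦X⟧} (hU : IsOpen U)
    (hψ : ∀ i, HasSeries U (m + m) (ψ i) (R i)) (hR : ∀ i j, AgreeBelow m (R i) (R j)) :
    HasSeries U (m + m) (fun h x => ∑ i, w i • ψ i h x) (∑ i, w i • R i) := by
  refine ⟨fun x hx => ?_, fun x hx g => ?_⟩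
  · simpa only [← Finset.sum_smul, hw, one_smul] using
      tendsto_finsetSum Finset.univ fun i _ => ((hψ i).tendsto x hx).const_smul (w i)
  have hclose (i j : ι) := ((hψ i).mono (m.le_add_left m)).sub_isBigO hU
    ((hψ j).mono (m.le_add_left m)) (hR i j) hx
  have hlin := sum_mul_apply_sub_apply_sum_isBigO hw (fun i => (hψ i).tendsto x hx) hclose
    (holo.analyticAt g hx)
  simp only [← pow_mul, mul_two] at hlin
  have hsum := IsBigO.fun_sum fun i (_ : i ∈ Finset.univ) =>
    ((hψ i).isBigO x hx g).const_mul_left (w i)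
  refine (hsum.sub hlin).congr_left fun p => ?_
  simp only [partialSum_sum_smul, mul_sub, Finset.sum_sub_distrib]
  ring

end HasSeries

lemma T₂_eq_sum (n : ℕ) (S : ℂ → (Fin d → ℂ) → Fin d → ℂ) :
    T₂ n S = fun h x => ∑ i, (1 / 4 : ℂ) • composition S (coeffs n i) h x := by
  funext h x
  simp only [T₂, Fin.sum_univ_four, smul_add]
  rfl

section Flow

variable {f : (Fin d → ℂ) → Fin d → ℂ} {φ S : ℂ → (Fin d → ℂ) → Fin d → ℂ}
  {P : (Module.End ℂ (holo U))⟦X⟧} {r : ℕ}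

lemma IsExactFlow.tendsto (hφ : IsExactFlow f U φ) (hx : x ∈ U) :
    Tendsto (fun h => φ h x) (𝓝 0) (𝓝 x) := by
  simpa only [ContinuousAt, (hφ x hx).1] using (hφ x hx).2.self_of_nhds.continuousAt

lemma IsExactFlow.analyticAt (hφ : IsExactFlow f U φ) (hx : x ∈ U) :
    AnalyticAt ℂ (fun h => φ h x) 0 :=
  Complex.analyticAt_iff_eventually_differentiableAt.mpr
    ((hφ x hx).2.mono fun _ h => h.differentiableAt)

lemma IsExactFlow.hasDerivAt_holo_comp (hφ : IsExactFlow f U φ) (hU : IsOpen U)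
    (hf : AnalyticOnNhd ℂ f U) (hx : x ∈ U) (g : holo U) :
    ∀ᶠ h in 𝓝 0, HasDerivAt (fun t => g (φ t x)) (lieDeriv hU hf g (φ h x)) h := by
  filter_upwards [(hφ x hx).2, (hφ.tendsto hx).eventually (hU.mem_nhds hx)] with h hd hmem
  rw [lieDeriv_apply hU hf g hmem]
  exact (holo.analyticAt g hmem).differentiableAt.hasFDerivAt.comp_hasDerivAt h hd

lemma IsExactFlow.iteratedDeriv_holo_comp (hφ : IsExactFlow f U φ) (hU : IsOpen U)
    (hf : AnalyticOnNhd ℂ f U) (hx : x ∈ U) (g : holo U) (k : ℕ) :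
    iteratedDeriv k (fun t => g (φ t x)) =ᶠ[𝓝 0] fun h => (lieDeriv hU hf ^ k) g (φ h x) := by
  induction k with
  | zero => rw [iteratedDeriv_zero]; rfl
  | succ k ih =>
    rw [iteratedDeriv_succ, pow_succ']
    refine ih.deriv.trans ?_
    filter_upwards [hφ.hasDerivAt_holo_comp hU hf hx ((lieDeriv hU hf ^ k) g)] with h hd
    exact hd.deriv

lemma IsExactFlow.isBigO (hφ : IsExactFlow f U φ) (hU : IsOpen U) (hf : AnalyticOnNhd ℂ f U)
    (hx : x ∈ U) (K : ℕ) (g : holo U) :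
    (fun h : ℂ => g (φ h x) - partialSum K (expSeries (lieDeriv hU hf) (1 : ℂ)) g (h, x))
      =O[𝓝 0] fun h => h ^ K := by
  have hG : AnalyticAt ℂ (fun p : ℂ × ℂ => g (φ p.1 x)) (0, 0) :=
    AnalyticAt.fun_comp (by simpa only [(hφ x hx).1] using holo.analyticAt g hx)
      (AnalyticAt.fun_comp (g := fun h => φ h x) (f := fun p : ℂ × ℂ => p.1)
        (hφ.analyticAt hx) analyticAt_fst)
  refine ((sub_taylorFst_isBigO K hG).comp_tendsto (k := fun h : ℂ => (h, 0))
    (Continuous.tendsto' (by fun_prop) _ _ rfl)).congr_left fun h => ?_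
  refine congrArg _ (Finset.sum_congr rfl fun k _ => congrArg _ ?_)
  have hderiv : iteratedDeriv k (fun t => g (φ t x)) 0 = (lieDeriv hU hf ^ k) g x := by
    simpa only [(hφ x hx).1] using (hφ.iteratedDeriv_holo_comp hU hf hx g k).self_of_nhds
  rw [hderiv, coeff_expSeries (lieDeriv hU hf) (1 : ℂ) k, one_pow, one_mul]
  rfl

lemma HasOrder.apply_zero (h : HasOrder U φ S r) (hφ : IsExactFlow f U φ) (hx : x ∈ U) :
    S 0 x = x := by
  have hzero := (h x hx).eq_zero_imp.self_of_nhds (zero_pow r.succ_ne_zero)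
  rwa [(hφ x hx).1, sub_eq_zero] at hzero

lemma HasOrder.agreeBelow (h : HasOrder U φ S r) (hφ : IsExactFlow f U φ) (hU : IsOpen U)
    (hf : AnalyticOnNhd ℂ f U) (hS : HasSeries U (r + 1) S P) :
    AgreeBelow (r + 1) P (expSeries (lieDeriv hU hf) (1 : ℂ)) := by
  refine agreeBelow_of_isBigO fun x hx g => ?_
  have hlip : (fun h : ℂ => g (S h x) - g (φ h x)) =O[𝓝 0] fun h => h ^ (r + 1) :=
    ((holo.analyticAt g hx).hasStrictFDerivAt.isBigO_sub.comp_tendsto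
      ((hS.tendsto_at hx).prodMk_nhds (hφ.tendsto hx))).trans (h x hx)
  refine ((hlip.sub (hS.isBigO_at hx g)).add (hφ.isBigO hU hf hx (r + 1) g)).congr_left
    fun z => ?_
  ring

lemma HasSeries.hasOrder (hS : HasSeries U (r + 1) S P) (hφ : IsExactFlow f U φ) (hU : IsOpen U)
    (hf : AnalyticOnNhd ℂ f U)
    (hP : AgreeBelow (r + 1) P (expSeries (lieDeriv hU hf) (1 : ℂ))) : HasOrder U φ S r := by
  refine fun x hx => isBigO_sub_of_holo hU hx (hS.tendsto_at hx) (hφ.tendsto hx) fun g => ?_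
  refine ((hS.isBigO_at hx g).sub (hφ.isBigO hU hf hx (r + 1) g)).congr_left fun z => ?_
  rw [hP.partialSum_eq, sub_sub_sub_cancel_right]

end Flow

lemma IsTimeSymmetric.scaleHom_neg_one_mul_self {S : ℂ → (Fin d → ℂ) → Fin d → ℂ}
    {P : (Module.End ℂ (holo U))⟦X⟧} (hsym : IsTimeSymmetric U S)
    (hS : ∀ K, HasSeries U K S P) : scaleHom (-1 : ℂ) P * P = 1 := by
  ext1 k
  refine agreeBelow_of_isBigO (K := k + 1) (fun x hx g => ?_) k k.lt_succ_self
  refine (((HasSeries.id (k + 1)).isBigO_at hx g).sub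
    (((hS (k + 1)).comp ((hS (k + 1)).scale (-1))).isBigO_at hx g)).congr' ?_ .rfl
  filter_upwards [hsym x hx] with h hh
  rw [Function.comp_apply, neg_one_mul, hh, id_eq, sub_sub_sub_cancel_left]

lemma HasSeries.isPseudoSymmetric {T : ℂ → (Fin d → ℂ) → Fin d → ℂ} {q : ℕ}
    {Q : (Module.End ℂ (holo U))⟦X⟧} (hT : HasSeries U (q + 1) T Q) (hU : IsOpen U)
    (hQ : AgreeBelow (q + 1) (scaleHom (-1 : ℂ) Q * Q) 1) : IsPseudoSymmetric U T q := by
  intro x hx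
  simpa only [Function.comp_def, neg_one_mul, id_eq] using
    ((hT.comp (hT.scale (-1))).sub_isBigO hU (HasSeries.id (q + 1)) hQ hx).comp_tendsto
      (Continuous.tendsto' (f := fun h : ℂ => (h, x)) (by fun_prop) 0 _ rfl)

theorem hasOrder_and_isPseudoSymmetric_T₂ {n : ℕ} (hn : 1 ≤ n)
    {f : (Fin d → ℂ) → Fin d → ℂ} {φ S : ℂ → (Fin d → ℂ) → Fin d → ℂ} (hU : IsOpen U)
    (hf : AnalyticOnNhd ℂ f U) (hφ : IsExactFlow f U φ) (hS : IsHolomorphicMethod U S)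
    (hord : HasOrder U φ S (2 * n)) (hsym : IsTimeSymmetric U S) :
    HasOrder U φ (T₂ n S) (2 * n + 4) ∧ IsPseudoSymmetric U (T₂ n S) (4 * n + 3) := by
  obtain ⟨P, hP⟩ := exists_hasSeries hU hS fun x hx => hord.apply_zero hφ hx
  have hPexp := hord.agreeBelow hφ hU hf (hP _)
  have hPsym := hsym.scaleHom_neg_one_mul_self hP
  have hclose := agreeBelow_compositionSeries_coeffs hn hPexp hPsym
  have hT : HasSeries U ((2 * n + 2) + (2 * n + 2)) (T₂ n S) (averageSeries n P) := by
    rw [T₂_eq_sum]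
    exact .sum_smul sum_fin_four_weights hU (fun i => (hP _).composition (coeffs n i))
      fun i j => (hclose i).trans (hclose j).symm
  exact ⟨(hT.mono (by lia)).hasOrder hφ hU hf (agreeBelow_averageSeries hn hPexp hPsym),
    (hT.mono (by lia)).isPseudoSymmetric hU (averageSeries_symmetric hn hPexp hPsym)⟩

end Order

section Real

variable {d n : ℕ} {U : Set (Fin d → ℂ)} {S : ℂ → (Fin d → ℂ) → Fin d → ℂ} {x : Fin d → ℂ}

lemma IsHolomorphicMethod.tendsto_composition (hS : IsHolomorphicMethod U S) (hx : x ∈ U)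
    (h0 : S 0 x = x) (α : List ℂ) : Tendsto (fun h => composition S α h x) (𝓝 0) (𝓝 x) := by
  induction α with
  | nil => exact tendsto_const_nhds
  | cons a α ih =>
    have harg : Tendsto (fun h : ℂ => (a * h, composition S α h x)) (𝓝 0) (𝓝 (0, x)) :=
      (Continuous.tendsto' (by fun_prop) _ _ (mul_zero a)).prodMk_nhds ih
    have hstep := (hS x hx).continuousAt.tendsto.comp harg
    rwa [h0] at hstep

lemma IsRealMethod.composition_map_conj (hreal : IsRealMethod U S) (hS : IsHolomorphicMethod U S)
    (hx : x ∈ U) (h0 : S 0 x = x) (hxr : star x = x) (α : List ℂ) :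
    ∀ᶠ h : ℝ in 𝓝 0, composition S (α.map fun a => conj a) h x = star (composition S α h x) := by
  induction α with
  | nil => exact Eventually.of_forall fun _ => hxr.symm
  | cons a α ih =>
    have hofReal : Tendsto ((↑) : ℝ → ℂ) (𝓝 0) (𝓝 0) :=
      Complex.continuous_ofReal.tendsto' _ _ Complex.ofReal_zero
    have harg : Tendsto (fun h : ℝ => (a * (h : ℂ), composition S α h x)) (𝓝 0) (𝓝 (0, x)) :=
      (Continuous.tendsto' (by fun_prop) _ _ (by rw [Complex.ofReal_zero, mul_zero])).prodMk_nhds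
        ((hS.tendsto_composition hx h0 α).comp hofReal)
    filter_upwards [ih, harg.eventually (hreal x hx hxr)] with h hα hstep
    calc composition S ((a :: α).map fun a => conj a) h x
        = S (conj (a * h)) (star (composition S α h x)) := by
          rw [← hα, map_mul, Complex.conj_ofReal]
          rfl
      _ = star (composition S (a :: α) h x) := hstep

lemma T₂_eq_re {h : ℂ}
    (h₃ : composition S (coeffs₃ n) h x = star (composition S (coeffs₁ n) h x))
    (h₄ : composition S (coeffs₄ n) h x = star (composition S (coeffs₂ n) h x)) :
    T₂ n S h x = fun i => (((1 / 2 : ℝ) * (composition S (coeffs₁ n) h x i +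
      composition S (coeffs₂ n) h x i).re : ℝ) : ℂ) := by
  funext i
  have hre := Complex.add_conj (composition S (coeffs₁ n) h x i + composition S (coeffs₂ n) h x i)
  rw [map_add] at hre
  simp only [T₂, h₃, h₄, Pi.smul_apply, Pi.add_apply, Pi.star_apply, smul_eq_mul, RCLike.star_def]
  push_cast at hre ⊢
  linear_combination (1 / 4) * hre

end Real

end TMethod

end

theorem mainTheorem3 (n : ℕ) (hn : 1 ≤ n) :
    -- the four coefficient sequences are consistent and symmetric-conjugate, and the last two are
    -- the complex conjugates of the first two
    (∀ α ∈ [TMethod.coeffs₁ n, TMethod.coeffs₂ n, TMethod.coeffs₃ n, TMethod.coeffs₄ n],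
      TMethod.IsSymmetricConjugate α ∧ α.sum = 1) ∧
    TMethod.coeffs₃ n = (TMethod.coeffs₁ n).map (fun a => conj a) ∧
    TMethod.coeffs₄ n = (TMethod.coeffs₂ n).map (fun a => conj a) ∧
    -- the `μ_{2n+1,1}` and `μ_{2n+3,1}` terms of the two paired compositions vanish, and their
    -- (nonzero) `μ_{2n+3,2}` terms cancel
    (∃ σ₁ σ₂ m : ℝ, m ≠ 0 ∧ TMethod.HasExpansion n (TMethod.coeffs₁ n) 0 σ₁ 0 m ∧
      TMethod.HasExpansion n (TMethod.coeffs₂ n) 0 σ₂ 0 (-m)) ∧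
    -- for every time-symmetric basic method of order `2n`, the method `T_h^(2)` has order `2n+4`
    -- and is pseudo-symmetric of order `4n+3`
    (∀ (d : ℕ) (U : Set (Fin d → ℂ)) (f : (Fin d → ℂ) → (Fin d → ℂ))
      (φ S : ℂ → (Fin d → ℂ) → (Fin d → ℂ)),
      IsOpen U → AnalyticOnNhd ℂ f U → TMethod.IsExactFlow f U φ →
      TMethod.IsHolomorphicMethod U S → TMethod.HasOrder U φ S (2 * n) →
      TMethod.IsTimeSymmetric U S →
        TMethod.HasOrder U φ (TMethod.T₂ n S) (2 * n + 4) ∧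
        TMethod.IsPseudoSymmetric U (TMethod.T₂ n S) (4 * n + 3) ∧
        -- if the basic method is real, the last two compositions are the complex conjugates of the
        -- first two, and `T_h^(2)` is half the real part of the sum of the first two
        (TMethod.IsRealMethod U S → ∀ x ∈ U, star x = x → ∀ᶠ h : ℝ in 𝓝 0,
          TMethod.composition S (TMethod.coeffs₃ n) h x =
            star (TMethod.composition S (TMethod.coeffs₁ n) h x) ∧
          TMethod.composition S (TMethod.coeffs₄ n) h x =
            star (TMethod.composition S (TMethod.coeffs₂ n) h x) ∧
          TMethod.T₂ n S h x = fun i => (((1 / 2 : ℝ) *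
            (TMethod.composition S (TMethod.coeffs₁ n) h x i +
              TMethod.composition S (TMethod.coeffs₂ n) h x i).re : ℝ) : ℂ))) := by
  refine ⟨?_, (TMethod.coeffs_map_conj n 0).symm, (TMethod.coeffs_map_conj n 1).symm,
    TMethod.exists_hasExpansion hn, ?_⟩
  · have hmem : ∀ α ∈ List.ofFn (TMethod.coeffs n), TMethod.IsSymmetricConjugate α ∧ α.sum = 1 :=
      List.forall_mem_ofFn_iff.mpr fun i =>
        ⟨TMethod.isSymmetricConjugate_coeffs n i, TMethod.coeffs_sum n i⟩
    exact hmem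
  · intro d U f φ S hU hf hφ hS hord hsym
    obtain ⟨hT, hpseudo⟩ := TMethod.hasOrder_and_isPseudoSymmetric_T₂ hn hU hf hφ hS hord hsym
    refine ⟨hT, hpseudo, fun hreal x hx hxr => ?_⟩
    have h0 := hord.apply_zero hφ hx
    filter_upwards [hreal.composition_map_conj hS hx h0 hxr (TMethod.coeffs n 0),
      hreal.composition_map_conj hS hx h0 hxr (TMethod.coeffs n 1)] with h h₃ h₄
    rw [TMethod.coeffs_map_conj] at h₃ h₄
    exact ⟨h₃, h₄, TMethod.T₂_eq_re h₃ h₄⟩
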